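/- Conventions. A finite generating set $X$ of a group $G$ is a finite set of symbols with a map to $G$ whose image generates $G$; $A = X\cup X^{-1}$ is the alphabet consisting of a symbol $x$ and a symbol $x^{-1}$ for each $x\in X$; $\$$ is an additional symbol that maps to the identity of $G$, and $A' = A\cup\{\$\}$. We write $\overline{w}\in G$ for the image of a word $w\in A^*$, $=_G$ for equality of images in $G$, $l_A(g)$ for the length of a shortest word over $A$ with image $g$, and $w(t)$ for the prefix of $w$ of length $\min(t,|w|)$. The padded pair $(w^+,x^+)$ of $w,x\in A^*$ is the word over $A'\times A'$ obtained by adjoining symbols $\$$ to the end of the shorter word until both have the same length. $L(W)$ is the language of the finite state automaton $W$. * $G$ is *automatic* if for some finite generating set $X$ there are finite state automata $W$ over $A$ and $M_a$ over $A'\times A'$ ($a\in A'$) such that $L(W)$ maps onto $G$, each $M_a$ accepts only padded pairs, and $M_a$ accepts $(w^+,x^+)$ if and only if $w,x\in L(W)$ and $wa=_G x$. * $G$ is *asynchronously automatic* if the same holds with each $M_a$ replaced by a deterministic asynchronous two-tape automaton: a finite automaton that reads one symbol from one of its two input tapes (each word being followed by an end marker) at each transition, the tape to be read being a function of the state, and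 that accepts $(w,x)$ if it reads both tapes to the end, markers included, and is then in an accept state. It is required that $M_a$ accepts $(w,x)$ if and only if $w,x\in L(W)$ and $wa=_G x$. * Let $H\le G$. An *automatic coset system* $\{W,M_a\}$ for $(G,H)$ with respect to a finite generating set $X$ of $G$ consists of finite state automata $W$ over $A$ and $M_a$ over $A'\times A'$ ($a\in A'$) such that $W$ accepts at least one word in each right coset of $H$ in $G$, each $M_a$ accepts only padded pairs, and $M_a$ accepts $(w^+,x^+)$ if and only if $w,x\in L(W)$ and $H\overline{wa}=H\overline{x}$. It is *strong* if there is a constant $k$ such that, for all $a\in A$, $w,x\in A^*$ and $h\in H$ with $(w^+,x^+)\in L(M_a)$ and $wa=_G hx$, and for all $t\ge 0$, $l_A(\overline{w(t)}^{-1}h\,\overline{x(t)})\le k$. * A finite generating set $Y\subseteq H$ of $H$ is *efficient* with respect to $\{W,M_a\}$ if, with $B=Y\cup Y^{-1}$, for all $w,x\in L(W)$, $b\in B$ and $h\in H$ with $wb=_G hx$, either $h=1$ or $h\in B$. **Theorem.** Let $G=\langle X\mid R\rangle$ be a finitely presented group, let $H$ be a subgroup of $G$, and let $\{W,M_a\}$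 be a strong automatic coset system for $(G,H)$ (with respect to some finite generating set of $G$, for example $X$). Suppose that $H$ is automatic, that $Y$ is a finite generating set of $H$ that is efficient with respect to $\{W,M_a\}$, and that $\alpha$ is an automorphism of $H$ with $\alpha(Y)=Y$. Then the HNN extension $$K=\langle X,z\mid R,\ z^{-1}yz=\alpha(y)\ (y\in Y)\rangle,$$ in which each element of $Y$ is written as any fixed word in $X$ that represents it, is asynchronously automatic. -/

import Mathlib

/-! Words over the alphabet `A = X ∪ X⁻¹` attached to a family of generators `gen : X → G`.
The letters of `A` are the formal symbols `(x, true)` (standing for `x`) and `(x, false)` (standing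
for `x⁻¹`); the alphabet `A' = A ∪ {$}` is `Option (X × Bool)`, with `none` as the symbol `$`. -/

/-- The element of `G` onto which a letter of `A = X ∪ X⁻¹` maps. -/
def letterVal {X G : Type*} [Group G] (gen : X → G) (a : X × Bool) : G :=
  if a.2 then gen a.1 else (gen a.1)⁻¹

/-- The element of `G` onto which a letter of `A' = A ∪ {$}` maps; `$` maps onto the identity. -/
def paddedLetterVal {X G : Type*} [Group G] (gen : X → G) : Option (X × Bool) → G
  | none => 1
  | some a => letterVal gen a

/-- The element of `G` onto which a word over `A` maps. -/
def wordVal {X G : Type*} [Group G] (gen : X → G) (w : List (X × Bool)) : G :=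
  (w.map (letterVal gen)).prod

/-- `l_A(g)`: the length of a shortest word over `A` that maps onto `g`. It is only used for
families of generators, so that the set below is nonempty. -/
noncomputable def wordLength {X G : Type*} [Group G] (gen : X → G) (g : G) : ℕ :=
  sInf {n : ℕ | ∃ w : List (X × Bool), w.length = n ∧ wordVal gen w = g}

/-- The padded pair `(w⁺, x⁺)`: the shorter of the two words is filled up with the symbol `$` at
its end, and the two resulting words of equal length are read as one word over `A' × A'`. -/
def paddedPair {A : Type*} (w x : List A) : List (Option A × Option A) :=
  List.zipWithAll Prod.mk w x

/-- The right coset `Hg`. -/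
def rightCoset {G : Type*} [Group G] (H : Subgroup G) (g : G) : Set G :=
  {k | ∃ h ∈ H, k = h * g}

/-! Automatic groups. -/

/-- An automatic structure `{W, M_a}` for the group `G` with respect to the finite family of
generators `gen : X → G`. -/
structure AutomaticStructure {X G : Type*} [Group G] (gen : X → G) where
  closure_range : Subgroup.closure (Set.range gen) = ⊤
  WState : Type
  finite_WState : Finite WState
  /-- The word-acceptor. -/
  W : DFA (X × Bool) WState
  MState : Option (X × Bool) → Type
  finite_MState : ∀ a, Finite (MState a)
  /-- The multiplier automata. -/
  M : ∀ a, DFA (Option (X × Bool) × Option (X × Bool)) (MState a)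
  exists_word : ∀ g : G, ∃ w ∈ W.accepts, wordVal gen w = g
  accepts_padded : ∀ a, ∀ p ∈ (M a).accepts, ∃ w x, p = paddedPair w x
  accepts_iff : ∀ a w x, paddedPair w x ∈ (M a).accepts ↔
    w ∈ W.accepts ∧ x ∈ W.accepts ∧ wordVal gen w * paddedLetterVal gen a = wordVal gen x

/-- A group is automatic if it has an automatic structure for some finite family of generators. -/
def IsAutomatic (G : Type*) [Group G] : Prop :=
  ∃ (X : Type) (_ : Finite X) (gen : X → G), Nonempty (AutomaticStructure gen)

/-! Coset automatic groups. -/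

/-- An automatic coset system `{W, M_a}` for the pair `(G, H)` with respect to the finite family of
generators `gen : X → G` of `G`. -/
structure AutomaticCosetSystem {X G : Type*} [Group G] (gen : X → G) (H : Subgroup G) where
  closure_range : Subgroup.closure (Set.range gen) = ⊤
  WState : Type
  finite_WState : Finite WState
  /-- The coset word-acceptor. -/
  W : DFA (X × Bool) WState
  MState : Option (X × Bool) → Type
  finite_MState : ∀ a, Finite (MState a)
  /-- The coset multiplier automata. -/
  M : ∀ a, DFA (Option (X × Bool) × Option (X × Bool)) (MState a)
  exists_word : ∀ g : G, ∃ w ∈ W.accepts, wordVal gen w ∈ rightCoset H g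
  accepts_padded : ∀ a, ∀ p ∈ (M a).accepts, ∃ w x, p = paddedPair w x
  accepts_iff : ∀ a w x, paddedPair w x ∈ (M a).accepts ↔
    w ∈ W.accepts ∧ x ∈ W.accepts ∧
      rightCoset H (wordVal gen w * paddedLetterVal gen a) = rightCoset H (wordVal gen x)

/-- An automatic coset system is strong if there is a constant `k` such that, whenever
`(w⁺, x⁺) ∈ L(M_a)` for a letter `a ∈ A` and `h ∈ H` satisfies `wa = hx` in `G`, all the elements
`w(t)⁻¹ h x(t)` have length at most `k`, where `w(t)` is the prefix of `w` of length `t` (and the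
whole of `w` if `t` exceeds the length of `w`). -/
def AutomaticCosetSystem.IsStrong {X G : Type*} [Group G] {gen : X → G} {H : Subgroup G}
    (C : AutomaticCosetSystem gen H) : Prop :=
  ∃ k : ℕ, ∀ (a : X × Bool) (w x : List (X × Bool)), paddedPair w x ∈ (C.M (some a)).accepts →
    ∀ h ∈ H, wordVal gen w * letterVal gen a = h * wordVal gen x →
      ∀ t : ℕ, wordLength gen ((wordVal gen (w.take t))⁻¹ * h * wordVal gen (x.take t)) ≤ k

/-- A set `Y` of elements of `H` is efficient with respect to `{W, M_a}` if, with
`B = Y ∪ Y⁻¹`, every equation `wb = hx` in `G` with `w, x ∈ L(W)`, `b ∈ B` and `h ∈ H` has `h = 1`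
or `h ∈ B`. -/
def AutomaticCosetSystem.IsEfficient {X G : Type*} [Group G] {gen : X → G} {H : Subgroup G}
    (C : AutomaticCosetSystem gen H) (Y : Set H) : Prop :=
  ∀ w ∈ C.W.accepts, ∀ x ∈ C.W.accepts, ∀ b h : H, (b ∈ Y ∨ b⁻¹ ∈ Y) →
    wordVal gen w * (b : G) = (h : G) * wordVal gen x → h = 1 ∨ h ∈ Y ∨ h⁻¹ ∈ Y

/-! Asynchronously automatic groups. -/

/-- A (deterministic) asynchronous two-tape automaton over the alphabet `A`. The state determines
which of the two tapes is read next: the left one if `readsLeft` is `true`, and the right one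
otherwise. The symbol read is a letter of `A`, or the end marker `none` at the end of the tape. -/
structure AsyncTwoTapeAutomaton (A σ : Type*) where
  readsLeft : σ → Bool
  step : σ → Option A → σ
  start : σ
  accept : Set σ

namespace AsyncTwoTapeAutomaton

/-- `M.AcceptsFrom s u v`: started in the state `s` with `u` and `v` as the parts of the left and
of the right tape that have not yet been read, the automaton reads both tapes completely and ends
in an accepting state. It fails if it wants to read a tape on which nothing is left. -/
inductive AcceptsFrom {A σ : Type*} (M : AsyncTwoTapeAutomaton A σ) :
    σ → List (Option A) → List (Option A) → Prop
  | done {s : σ} (hs : s ∈ M.accept) : AcceptsFrom M s [] []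
  | left {s : σ} {c : Option A} {u v : List (Option A)} (hs : M.readsLeft s = true)
      (h : AcceptsFrom M (M.step s c) u v) : AcceptsFrom M s (c :: u) v
  | right {s : σ} {c : Option A} {u v : List (Option A)} (hs : M.readsLeft s = false)
      (h : AcceptsFrom M (M.step s c) u v) : AcceptsFrom M s u (c :: v)

/-- The automaton accepts the pair of words `(u, v)`; each word is written on its tape with an end
marker behind it. -/
def Accepts {A σ : Type*} (M : AsyncTwoTapeAutomaton A σ) (u v : List A) : Prop :=
  M.AcceptsFrom M.start (u.map some ++ [none]) (v.map some ++ [none])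

end AsyncTwoTapeAutomaton

/-- An asynchronous automatic structure for the group `G` with respect to the finite family of
generators `gen : X → G`. -/
structure AsyncAutomaticStructure {X G : Type*} [Group G] (gen : X → G) where
  closure_range : Subgroup.closure (Set.range gen) = ⊤
  WState : Type
  finite_WState : Finite WState
  /-- The word-acceptor. -/
  W : DFA (X × Bool) WState
  MState : Option (X × Bool) → Type
  finite_MState : ∀ a, Finite (MState a)
  /-- The asynchronous multiplier automata. -/
  M : ∀ a, AsyncTwoTapeAutomaton (X × Bool) (MState a)
  exists_word : ∀ g : G, ∃ w ∈ W.accepts, wordVal gen w = g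
  accepts_iff : ∀ a w x, (M a).Accepts w x ↔
    w ∈ W.accepts ∧ x ∈ W.accepts ∧ wordVal gen w * paddedLetterVal gen a = wordVal gen x

/-- A group is asynchronously automatic if it has an asynchronous automatic structure for some
finite family of generators. -/
def IsAsyncAutomatic (G : Type*) [Group G] : Prop :=
  ∃ (X : Type) (_ : Finite X) (gen : X → G), Nonempty (AsyncAutomaticStructure gen)

/-! The presentation of the HNN extension. -/

/-- The relators of `⟨X, z | R, z⁻¹yz = α(y) (y ∈ Y)⟩`, where `G = ⟨X | R⟩` and `α` is an
automorphism of the subgroup `H` of `G`. The generators are `some x` for `x ∈ X`, and `z = none`;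
the elements `h` of `H` that occur are written as the words `word h` in the generators `X`. -/
def hnnRelators {X : Type*} (R : Set (FreeGroup X)) {H : Subgroup (PresentedGroup R)}
    (Y : Set H) (α : H ≃* H) (word : H → FreeGroup X) : Set (FreeGroup (Option X)) :=
  FreeGroup.map some '' R ∪
    {r | ∃ y ∈ Y, r = (FreeGroup.of none)⁻¹ * FreeGroup.map some (word y) * FreeGroup.of none *
      (FreeGroup.map some (word (α y)))⁻¹}

/-! ### Words -/

section Words

variable {X G : Type*} [Group G] (gen : X → G)

/-! The presented group `K` is the HNN extension of `G` with stable letter `z` and `H` as both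
associated subgroups. Each of its elements is represented by a word `v $ w z^{e₁} w₁ ⋯ z^{eₙ} wₙ`,
where `v` comes from an automatic structure of `H`, the words `w, wᵢ` come from the coset language
`L`, and no part `z^e wᵢ z^{-e}` has `wᵢ ∈ H`. To find it, replace the syllables of a reduced
expression by coset representatives from right to left and push the factors from `H` through the
stable letters (`exists_valList`). The language of these words is regular, since words of `L` with
value in `H` have only finitely many prefix values.

Let `P g = Q` for two such words and `g ∈ G`. By Britton's lemma they have the same exponents, and
matching syllables are linked by equations `wᵢ k = h xᵢ` with `h ∈ H`. At the right end `k = g`, and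
`h` lies in a finite set because the coset system is strong. Crossing a stable letter applies `α` or
its inverse, which keeps the length over `Y` because `α` permutes `Y`; crossing a further syllable
keeps `h` in a ball of the same radius by efficiency. So one finite subset of `H` contains all
linking elements, however many syllables there are (`exists_finite_invariant`), and in particular
`v⁻¹v'`. Fellow travelling inside each syllable then leaves finitely many word differences, provided
that the tapes wait for each other at `$` and at `z^{±1}` (`tail_differences`). Matching syllables
may differ in length, so the reading is asynchronous.

If `P z^e = Q`, then the last stable letter of `P` is cancelled by `z^e` or that of `Q` by `z^{-e}`.
Deleting the cancelled end of the word leads back to multiplication by one of finitely many elements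
of `G` (`stable_differences`).

Finiteness of the word differences suffices: a finite automaton can keep track of the current
difference (`isAsyncAutomatic_of_finite_wordDiff`). -/

@[simp]
theorem wordVal_nil : wordVal gen [] = 1 := rfl

@[simp]
theorem wordVal_cons (a : X × Bool) (w : List (X × Bool)) :
    wordVal gen (a :: w) = letterVal gen a * wordVal gen w := by
  simp [wordVal]

@[simp]
theorem wordVal_append (u v : List (X × Bool)) :
    wordVal gen (u ++ v) = wordVal gen u * wordVal gen v := by
  simp [wordVal]

theorem letterVal_map {G' : Type*} [Group G'] (f : G →* G') (a : X × Bool) :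
    letterVal (fun x => f (gen x)) a = f (letterVal gen a) := by
  unfold letterVal; split <;> simp

theorem wordVal_map {G' : Type*} [Group G'] (f : G →* G') (w : List (X × Bool)) :
    wordVal (fun x => f (gen x)) w = f (wordVal gen w) := by
  induction w with
  | nil => simp
  | cons a w ih => simp [ih, letterVal_map]

theorem paddedLetterVal_map {G' : Type*} [Group G'] (f : G →* G') (a : Option (X × Bool)) :
    paddedLetterVal (fun x => f (gen x)) a = f (paddedLetterVal gen a) := by
  cases a <;> simp [paddedLetterVal, letterVal_map]

theorem wordVal_relabel {X' : Type*} (e : X' → X) (w : List (X' × Bool)) :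
    wordVal gen (w.map (Prod.map e id)) = wordVal (gen ∘ e) w := by
  induction w with
  | nil => simp
  | cons a w ih => simp [ih, letterVal]

theorem closure_range_eq_top_of_forall_exists_word
    (h : ∀ g : G, ∃ w, wordVal gen w = g) : Subgroup.closure (Set.range gen) = ⊤ := by
  rw [eq_top_iff]
  rintro g -
  obtain ⟨w, rfl⟩ := h g
  clear h
  induction w with
  | nil => simp
  | cons a w ih =>
    rw [wordVal_cons]
    refine mul_mem ?_ ih
    have : gen a.1 ∈ Subgroup.closure (Set.range gen) := Subgroup.subset_closure ⟨_, rfl⟩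
    unfold letterVal
    split
    · exact this
    · exact inv_mem this

end Words

/-- The word on the left tape of a word of pairs, with the padding symbols removed. -/
abbrev leftTape {A : Type*} (p : List (Option A × Option A)) : List A := p.filterMap Prod.fst

/-- The word on the right tape of a word of pairs, with the padding symbols removed. -/
abbrev rightTape {A : Type*} (p : List (Option A × Option A)) : List A := p.filterMap Prod.snd

section Tapes

variable {A : Type*} (a : A) (c : Option A) (p : List (Option A × Option A))

theorem leftTape_cons_some : leftTape ((some a, c) :: p) = a :: leftTape p := by
  simp [leftTape]

theorem rightTape_cons_some : rightTape ((c, some a) :: p) = a :: rightTape p := by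
  simp [rightTape]

end Tapes

section PaddedPair

variable {A : Type*}

theorem tapes_take_paddedPair (w x : List A) (t : ℕ) :
    leftTape ((paddedPair w x).take t) = w.take t ∧
      rightTape ((paddedPair w x).take t) = x.take t := by
  induction t generalizing w x with
  | zero => simp
  | succ t ih =>
    cases w with
    | nil =>
      cases x with
      | nil => simp [paddedPair]
      | cons b x => simpa [paddedPair] using ih [] x
    | cons a w =>
      cases x with
      | nil => simpa [paddedPair] using ih w []
      | cons b x => simpa [paddedPair] using ih w x

theorem tapes_paddedPair (w x : List A) :
    leftTape (paddedPair w x) = w ∧ rightTape (paddedPair w x) = x := by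
  have h := tapes_take_paddedPair w x ((paddedPair w x).length + w.length + x.length)
  rwa [List.take_of_length_le (by omega), List.take_of_length_le (by omega),
    List.take_of_length_le (by omega)] at h

end PaddedPair

/-! ### Padding at delimiters -/

section AsyncPad

variable {A : Type*} (δ : A → Bool)

/-- The two words are read in parallel, and a tape on which a delimiter (a letter `a` with
`δ a = true`) is reached waits until a delimiter or the end is reached on the other tape. -/
def asyncPad : List A → List A → List (Option A × Option A)
  | [], [] => []
  | [], b :: v => (none, some b) :: asyncPad [] v
  | a :: u, [] => (some a, none) :: asyncPad u []
  | a :: u, b :: v =>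
    if δ a = δ b then (some a, some b) :: asyncPad u v
    else if δ a then (none, some b) :: asyncPad (a :: u) v
    else (some a, none) :: asyncPad u (b :: v)
termination_by u v => u.length + v.length

variable {δ}

@[simp]
theorem asyncPad_nil_nil : asyncPad δ [] [] = [] := by rw [asyncPad]

@[simp]
theorem asyncPad_nil_cons (b : A) (v : List A) :
    asyncPad δ [] (b :: v) = (none, some b) :: asyncPad δ [] v := by rw [asyncPad]

@[simp]
theorem asyncPad_cons_nil (a : A) (u : List A) :
    asyncPad δ (a :: u) [] = (some a, none) :: asyncPad δ u [] := by rw [asyncPad]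

theorem asyncPad_cons_cons_of_eq {a b : A} (h : δ a = δ b) (u v : List A) :
    asyncPad δ (a :: u) (b :: v) = (some a, some b) :: asyncPad δ u v := by
  rw [asyncPad, if_pos h]

theorem asyncPad_cons_cons_left {a b : A} (ha : δ a = true) (hb : δ b = false) (u v : List A) :
    asyncPad δ (a :: u) (b :: v) = (none, some b) :: asyncPad δ (a :: u) v := by
  rw [asyncPad, if_neg (by simp [ha, hb]), if_pos ha]

theorem asyncPad_cons_cons_right {a b : A} (ha : δ a = false) (hb : δ b = true) (u v : List A) :
    asyncPad δ (a :: u) (b :: v) = (some a, none) :: asyncPad δ u (b :: v) := by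
  rw [asyncPad, if_neg (by simp [ha, hb]), if_neg (by simp [ha])]

theorem tapes_asyncPad (u v : List A) :
    leftTape (asyncPad δ u v) = u ∧ rightTape (asyncPad δ u v) = v := by
  fun_induction asyncPad δ u v with
  | case1 => simp
  | case2 b v ih => exact ⟨by simpa [leftTape] using ih.1, by simp [ih.2]⟩
  | case3 a u ih => exact ⟨by simp [ih.1], by simpa [rightTape] using ih.2⟩
  | case4 a u b v h ih => simp [ih]
  | case5 a u b v h h' ih => simp [ih]
  | case6 a u b v h h' ih => simp [ih]

theorem asyncPad_swap (u v : List A) :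
    asyncPad δ v u = (asyncPad δ u v).map Prod.swap := by
  fun_induction asyncPad δ u v with
  | case1 => simp
  | case2 b v ih => simp [ih]
  | case3 a u ih => simp [ih]
  | case4 a u b v h ih => simp [asyncPad_cons_cons_of_eq h.symm, ih]
  | case5 a u b v h h' ih =>
    rw [asyncPad_cons_cons_right (by simpa [h'] using h) h', ih]; simp
  | case6 a u b v h h' ih =>
    have ha : δ a = false := by simpa using h'
    rw [asyncPad_cons_cons_left (by simpa [ha] using h) ha, ih]; simp

theorem leftTape_map_swap (p : List (Option A × Option A)) :
    leftTape (p.map Prod.swap) = rightTape p := by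
  simp [leftTape, rightTape, List.filterMap_map]

theorem rightTape_map_swap (p : List (Option A × Option A)) :
    rightTape (p.map Prod.swap) = leftTape p := by
  simp [leftTape, rightTape, List.filterMap_map]

theorem exists_prefix_asyncPad_swap {u v : List A} {p : List (Option A × Option A)}
    (hp : p <+: asyncPad δ u v) :
    ∃ p', p' <+: asyncPad δ v u ∧ leftTape p = rightTape p' ∧ rightTape p = leftTape p' := by
  refine ⟨p.map Prod.swap, ?_, (rightTape_map_swap p).symm, (leftTape_map_swap p).symm⟩
  rw [asyncPad_swap u v]
  exact hp.map _

theorem tapes_prefix_asyncPad_nil {v : List A} {p : List (Option A × Option A)}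
    (hp : p <+: asyncPad δ [] v) : ∃ t, leftTape p = [] ∧ rightTape p = v.take t := by
  induction p generalizing v with
  | nil => exact ⟨0, by simp⟩
  | cons c p ih =>
    cases v with
    | nil => simp at hp
    | cons b v =>
      rw [asyncPad_nil_cons, List.cons_prefix_cons] at hp
      obtain ⟨rfl, hp⟩ := hp
      obtain ⟨t, h1, h2⟩ := ih hp
      exact ⟨t + 1, by simpa using h1, by simp [h2]⟩

/-- Within a delimiter-free block both tapes advance together, and the tape with the shorter block
waits at its delimiter or end. As `take` saturates, a single `t` describes both tapes until the
blocks are finished. -/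
theorem tapes_prefix_asyncPad_append {w x r₁ r₂ : List A} (hw : ∀ a ∈ w, δ a = false)
    (hx : ∀ a ∈ x, δ a = false) (hr₁ : ∀ a ∈ r₁.head?, δ a = true)
    (hr₂ : ∀ a ∈ r₂.head?, δ a = true) {p : List (Option A × Option A)}
    (hp : p <+: asyncPad δ (w ++ r₁) (x ++ r₂)) :
    (∃ t, leftTape p = w.take t ∧ rightTape p = x.take t) ∨
      ∃ p', p' <+: asyncPad δ r₁ r₂ ∧ leftTape p = w ++ leftTape p' ∧
        rightTape p = x ++ rightTape p' := by
  induction p generalizing w x with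
  | nil => exact Or.inl ⟨0, by simp⟩
  | cons c p ih =>
    cases w with
    | nil =>
      cases x with
      | nil => exact Or.inr ⟨_, hp, rfl, rfl⟩
      | cons b x =>
        have key : asyncPad δ ([] ++ r₁) (b :: x ++ r₂) =
            (none, some b) :: asyncPad δ ([] ++ r₁) (x ++ r₂) := by
          cases r₁ with
          | nil => simp
          | cons z r₁ =>
            exact asyncPad_cons_cons_left (hr₁ z (by simp)) (hx b (by simp)) _ _
        rw [key, List.cons_prefix_cons] at hp
        obtain ⟨rfl, hp⟩ := hp
        rcases ih hw (fun a ha => hx a (by simp [ha])) hp with ⟨t, h1, h2⟩ | ⟨p', h1, h2, h3⟩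
        · exact Or.inl ⟨t + 1, by simpa using h1, by simp [h2]⟩
        · exact Or.inr ⟨p', h1, by simpa using h2, by simp [h3]⟩
    | cons a w =>
      cases x with
      | nil =>
        have key : asyncPad δ (a :: w ++ r₁) ([] ++ r₂) =
            (some a, none) :: asyncPad δ (w ++ r₁) ([] ++ r₂) := by
          cases r₂ with
          | nil => simp
          | cons z r₂ =>
            exact asyncPad_cons_cons_right (hw a (by simp)) (hr₂ z (by simp)) _ _
        rw [key, List.cons_prefix_cons] at hp
        obtain ⟨rfl, hp⟩ := hp
        rcases ih (fun a ha => hw a (by simp [ha])) hx hp with ⟨t, h1, h2⟩ | ⟨p', h1, h2, h3⟩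
        · exact Or.inl ⟨t + 1, by simp [h1], by simpa using h2⟩
        · exact Or.inr ⟨p', h1, by simp [h2], by simpa using h3⟩
      | cons b x =>
        rw [List.cons_append, List.cons_append, asyncPad_cons_cons_of_eq
          ((hw a (by simp)).trans (hx b (by simp)).symm), List.cons_prefix_cons] at hp
        obtain ⟨rfl, hp⟩ := hp
        rcases ih (fun a ha => hw a (by simp [ha])) (fun a ha => hx a (by simp [ha])) hp with
          ⟨t, h1, h2⟩ | ⟨p', h1, h2, h3⟩
        · exact Or.inl ⟨t + 1, by simp [h1], by simp [h2]⟩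
        · exact Or.inr ⟨p', h1, by simp [h2], by simp [h3]⟩

end AsyncPad

/-! ### Asynchronous automata from automata on padded pairs -/

namespace AsyncTwoTapeAutomaton

variable {A σ : Type*}

theorem acceptsFrom_cons_left {M : AsyncTwoTapeAutomaton A σ} {s : σ}
    (hs : M.readsLeft s = true) (c : Option A) (u v : List (Option A)) :
    M.AcceptsFrom s (c :: u) v ↔ M.AcceptsFrom (M.step s c) u v := by
  refine ⟨fun h => ?_, .left hs⟩
  cases h with
  | left _ h => exact h
  | right hs' _ => simp [hs] at hs'

theorem acceptsFrom_cons_right {M : AsyncTwoTapeAutomaton A σ} {s : σ}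
    (hs : M.readsLeft s = false) (c : Option A) (u v : List (Option A)) :
    M.AcceptsFrom s u (c :: v) ↔ M.AcceptsFrom (M.step s c) u v := by
  refine ⟨fun h => ?_, .right hs⟩
  cases h with
  | left hs' _ => simp [hs] at hs'
  | right _ h => exact h

theorem acceptsFrom_nil_nil {M : AsyncTwoTapeAutomaton A σ} {s : σ} :
    M.AcceptsFrom s [] [] ↔ s ∈ M.accept := by
  refine ⟨fun h => ?_, .done⟩
  cases h with
  | done h => exact h

end AsyncTwoTapeAutomaton

section OfDFA

variable {A σ : Type*} (δ : A → Bool) (M : DFA (Option A × Option A) σ)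

/-- The state reached when one symbol of each tape is stored: at least one of them is
passed on to the automaton `M`. -/
def asyncConsume (q : σ) : Option A → Option A → σ × Option (Option A) × Option (Option A)
  | none, none => (q, some none, some none)
  | none, some b => (M.step q (none, some b), some none, none)
  | some a, none => (M.step q (some a, none), none, some none)
  | some a, some b =>
    if δ a = δ b then (M.step q (some a, some b), none, none)
    else if δ a then (M.step q (none, some b), some (some a), none)
    else (M.step q (some a, none), none, some (some b))

/-- The asynchronous automaton that runs `M` on the words `asyncPad δ u v`. A state consists
of a state of `M` and, for each tape, the symbol that has been read but not yet been used. -/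
def DFA.toAsync : AsyncTwoTapeAutomaton A (σ × Option (Option A) × Option (Option A)) where
  readsLeft s := s.2.1.isNone
  step s c :=
    match s with
    | (q, none, none) => (q, some c, none)
    | (q, none, some d) => asyncConsume δ M q c d
    | (q, some d, _) => asyncConsume δ M q d c
  start := (M.start, none, none)
  accept := {s | s.1 ∈ M.accept ∧ s.2.1 = some none ∧ s.2.2 = some none}

/-- A word with an end marker behind it. -/
abbrev tape (u : List A) : List (Option A) := u.map some ++ [none]

theorem tape_eq_cons (u : List A) : tape u = u.head? :: (tape u).tail := by
  cases u <;> simp [tape]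

/-- After a step of `M`, the left buffer, the right buffer or both are full or empty according to
which letters were used. This lemma and the next two refill what is empty, so that the induction
only meets states with one symbol of each tape in store. -/
theorem toAsync_acceptsFrom_left (q : σ) (u v : List A) :
    (M.toAsync δ).AcceptsFrom (q, some u.head?, none) (tape u).tail (tape v) ↔
      (M.toAsync δ).AcceptsFrom (asyncConsume δ M q u.head? v.head?)
        (tape u).tail (tape v).tail := by
  conv_lhs => rw [tape_eq_cons v]
  rw [AsyncTwoTapeAutomaton.acceptsFrom_cons_right (by rfl)]
  rfl

theorem toAsync_acceptsFrom_right (q : σ) (u v : List A) :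
    (M.toAsync δ).AcceptsFrom (q, none, some v.head?) (tape u) (tape v).tail ↔
      (M.toAsync δ).AcceptsFrom (asyncConsume δ M q u.head? v.head?)
        (tape u).tail (tape v).tail := by
  conv_lhs => rw [tape_eq_cons u]
  rw [AsyncTwoTapeAutomaton.acceptsFrom_cons_left (by rfl)]
  rfl

theorem toAsync_acceptsFrom_empty (q : σ) (u v : List A) :
    (M.toAsync δ).AcceptsFrom (q, none, none) (tape u) (tape v) ↔
      (M.toAsync δ).AcceptsFrom (asyncConsume δ M q u.head? v.head?)
        (tape u).tail (tape v).tail := by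
  conv_lhs => rw [tape_eq_cons u]
  rw [AsyncTwoTapeAutomaton.acceptsFrom_cons_left (by rfl)]
  exact toAsync_acceptsFrom_left δ M q u v

theorem toAsync_acceptsFrom (q : σ) (u v : List A) :
    (M.toAsync δ).AcceptsFrom (asyncConsume δ M q u.head? v.head?)
        (tape u).tail (tape v).tail ↔
      M.evalFrom q (asyncPad δ u v) ∈ M.accept := by
  fun_induction asyncPad δ u v generalizing q with
  | case1 =>
    refine AsyncTwoTapeAutomaton.acceptsFrom_nil_nil.trans ?_
    simp [asyncConsume, DFA.toAsync]
  | case2 b v ih =>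
    rw [DFA.evalFrom_cons, ← ih]
    exact toAsync_acceptsFrom_left δ M _ [] v
  | case3 a u ih =>
    rw [DFA.evalFrom_cons, ← ih]
    exact toAsync_acceptsFrom_right δ M _ u []
  | case4 a u b v h ih =>
    rw [DFA.evalFrom_cons, ← ih]
    refine Iff.trans ?_ (toAsync_acceptsFrom_empty δ M _ u v)
    rw [List.head?_cons, List.head?_cons, asyncConsume, if_pos h]
    rfl
  | case5 a u b v h h' ih =>
    rw [DFA.evalFrom_cons, ← ih]
    refine Iff.trans ?_ (toAsync_acceptsFrom_left δ M _ (a :: u) v)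
    rw [List.head?_cons, List.head?_cons, asyncConsume, if_neg h, if_pos h']
    rfl
  | case6 a u b v h h' ih =>
    rw [DFA.evalFrom_cons, ← ih]
    refine Iff.trans ?_ (toAsync_acceptsFrom_right δ M _ u (b :: v))
    rw [List.head?_cons, List.head?_cons, asyncConsume, if_neg h, if_neg h']
    rfl

theorem toAsync_accepts (u v : List A) :
    (M.toAsync δ).Accepts u v ↔ asyncPad δ u v ∈ M.accepts :=
  (toAsync_acceptsFrom_empty δ M M.start u v).trans (toAsync_acceptsFrom δ M M.start u v)

end OfDFA

/-! ### Regular languages -/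

namespace Language

theorem IsRegular.preimage_map {A A' : Type*} {L : Language A} (hL : L.IsRegular) (f : A' → A) :
    IsRegular ({w | w.map f ∈ L} : Language A') := by
  obtain ⟨σ, _, M, rfl⟩ := hL
  exact ⟨σ, inferInstance, M.comap f, by rw [DFA.accepts_comap]; rfl⟩

/-- Letters that are erased by `f` leave the state unchanged. With `f` a projection this checks one
tape of a word of pairs and ignores the padding. -/
theorem IsRegular.preimage_filterMap {A A' : Type*} {L : Language A} (hL : L.IsRegular)
    (f : A' → Option A) : IsRegular ({w | w.filterMap f ∈ L} : Language A') := by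
  obtain ⟨σ, _, M, rfl⟩ := hL
  let N : DFA A' σ := ⟨fun s a => (f a).elim s (M.step s), M.start, M.accept⟩
  have key : ∀ s w, N.evalFrom s w = M.evalFrom s (w.filterMap f) := by
    intro s w
    induction w generalizing s with
    | nil => rfl
    | cons a w ih =>
      rw [DFA.evalFrom_cons, ih]
      cases h : f a <;> simp [N, h]
  refine ⟨σ, inferInstance, N, ?_⟩
  ext w
  change N.evalFrom M.start w ∈ M.accept ↔ M.evalFrom M.start (w.filterMap f) ∈ M.accept
  rw [key]

/-- The words along which a deterministic system, whose state space may be infinite, stays in a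
finite set of states and ends in `E`. -/
theorem isRegular_of_finite_track {Γ Q : Type*} (step : Q → Γ → Q) (q₀ : Q) {D : Set Q}
    (hD : D.Finite) (E : Set Q) :
    IsRegular ({w | (∀ p, p <+: w → p.foldl step q₀ ∈ D) ∧ w.foldl step q₀ ∈ E} : Language Γ) := by
  classical
  have := hD.to_subtype
  -- The state `none` is a sink that is entered as soon as the system leaves `D`.
  let into : Q → Option D := fun q => if h : q ∈ D then some ⟨q, h⟩ else none
  have into_eq : ∀ q (h : q ∈ D), into q = some ⟨q, h⟩ := fun q h => dif_pos h
  have into_none : ∀ q, q ∉ D → into q = none := fun q h => dif_neg h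
  let N : DFA Γ (Option D) :=
    ⟨fun s a => s.elim none fun d => into (step d a), into q₀, {s | ∃ d, s = some d ∧ (d : Q) ∈ E}⟩
  have dead : ∀ w, N.evalFrom none w = none := by
    intro w
    induction w with
    | nil => rfl
    | cons a w ih => rw [DFA.evalFrom_cons]; exact ih
  have key : ∀ w q, N.evalFrom (into q) w ∈ N.accept ↔
      (∀ p, p <+: w → p.foldl step q ∈ D) ∧ w.foldl step q ∈ E := by
    intro w
    induction w with
    | nil =>
      intro q
      by_cases hq : q ∈ D
      · simp [N, into_eq q hq, hq]
      · simp [N, into_none q hq, hq]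
    | cons a w ih =>
      intro q
      by_cases hq : q ∈ D
      · have : N.step (into q) a = into (step q a) := by rw [into_eq q hq]; rfl
        rw [DFA.evalFrom_cons, this, ih]
        refine and_congr_left fun _ => ⟨fun h p hp => ?_, fun h p hp => ?_⟩
        · cases p with
          | nil => exact hq
          | cons b p =>
            obtain ⟨rfl, hp'⟩ := List.cons_prefix_cons.1 hp
            exact h p hp'
        · exact h (a :: p) (List.cons_prefix_cons.2 ⟨rfl, hp⟩)
      · rw [into_none q hq, dead]
        refine iff_of_false (by simp [N]) fun h => hq (h.1 [] (by simp))
  have := Fintype.ofFinite (Option D)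
  exact isRegular_iff.2 ⟨Option D, inferInstance, N, Set.ext fun w => key w q₀⟩

end Language

/-! ### A criterion for asynchronous automaticity -/

section Criterion

variable {T K : Type*} [Group K] (gen : T → K)

/-- The word difference of a word of pairs. -/
def wordDiff (p : List (Option (T × Bool) × Option (T × Bool))) : K :=
  (wordVal gen (leftTape p))⁻¹ * wordVal gen (rightTape p)

/-- The new word difference depends only on the old one and on the pair just read, so word
differences can serve as the states of an automaton. -/
theorem wordDiff_eq_foldl (p : List (Option (T × Bool) × Option (T × Bool))) :
    p.foldl (fun d c => (paddedLetterVal gen c.1)⁻¹ * d * paddedLetterVal gen c.2) 1 =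
      wordDiff gen p := by
  induction p using List.reverseRecOn with
  | nil => simp [wordDiff]
  | append_singleton p c ih =>
    rw [List.foldl_append, ih]
    obtain ⟨a, b⟩ := c
    cases a <;> cases b <;>
      simp [wordDiff, paddedLetterVal, leftTape, rightTape, mul_assoc]

end Criterion

/-- A group with a regular set of representing words is asynchronously automatic if words for
elements that differ by a generator have boundedly many word differences when they are read in
the way that is prescribed by the delimiters. -/
theorem isAsyncAutomatic_of_finite_wordDiff {T : Type} [Finite T] {K : Type*} [Group K]
    (gen : T → K) (L : Language (T × Bool)) (hL : L.IsRegular) (δ : T × Bool → Bool)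
    (hsurj : ∀ g : K, ∃ w ∈ L, wordVal gen w = g)
    (hdiff : ∀ a, ∃ D : Set K, D.Finite ∧ ∀ u ∈ L, ∀ v ∈ L,
      wordVal gen u * paddedLetterVal gen a = wordVal gen v →
        ∀ p, p <+: asyncPad δ u v → wordDiff gen p ∈ D) :
    IsAsyncAutomatic K := by
  choose D hD hdiff using hdiff
  -- The automaton need not recognise which words of pairs have the form `asyncPad δ u v`, since
  -- `DFA.toAsync` feeds it only such words.
  have hreg := fun a => (Language.isRegular_of_finite_track (fun d
    (c : Option (T × Bool) × Option (T × Bool)) =>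
      (paddedLetterVal gen c.1)⁻¹ * d * paddedLetterVal gen c.2) 1 (hD a)
      {paddedLetterVal gen a}).inf
        ((hL.preimage_filterMap Prod.fst).inf (hL.preimage_filterMap Prod.snd))
  choose σ hσ M hM using hreg
  obtain ⟨τ, _, W, hW⟩ := hL
  refine ⟨T, inferInstance, gen, ⟨{
    closure_range := closure_range_eq_top_of_forall_exists_word gen
      fun g => (hsurj g).imp fun _ h => h.2
    WState := τ
    finite_WState := inferInstance
    W := W
    MState := fun a => σ a × Option (Option (T × Bool)) × Option (Option (T × Bool))
    finite_MState := fun a => inferInstance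
    M := fun a => (M a).toAsync δ
    exists_word := by rwa [hW]
    accepts_iff := ?_ }⟩⟩
  intro a u v
  rw [toAsync_accepts, hM, hW]
  have h1 := (tapes_asyncPad (δ := δ) u v).1
  have h2 := (tapes_asyncPad (δ := δ) u v).2
  have h3 : (paddedLetterVal gen a = wordDiff gen (asyncPad δ u v)) ↔
      wordVal gen u * paddedLetterVal gen a = wordVal gen v := by
    rw [wordDiff, h1, h2, eq_inv_mul_iff_mul_eq]
  constructor
  · rintro ⟨⟨-, h⟩, hu, hv⟩
    change leftTape _ ∈ L at hu
    change rightTape _ ∈ L at hv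
    rw [h1] at hu
    rw [h2] at hv
    rw [wordDiff_eq_foldl] at h
    exact ⟨hu, hv, h3.1 h.symm⟩
  · rintro ⟨hu, hv, h⟩
    refine ⟨⟨fun p hp => ?_, ?_⟩, ?_, ?_⟩
    · rw [wordDiff_eq_foldl]
      exact hdiff a u hu v hv h p hp
    · rw [wordDiff_eq_foldl]
      exact (h3.2 h).symm
    · change leftTape _ ∈ L
      rwa [h1]
    · change rightTape _ ∈ L
      rwa [h2]

theorem IsAsyncAutomatic.of_mulEquiv {K K' : Type*} [Group K] [Group K'] (e : K ≃* K')
    (h : IsAsyncAutomatic K) : IsAsyncAutomatic K' := by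
  obtain ⟨X, hX, gen, ⟨S⟩⟩ := h
  have hval : ∀ w, wordVal (fun x => e (gen x)) w = e (wordVal gen w) :=
    wordVal_map gen e.toMonoidHom
  have hval' : ∀ a, paddedLetterVal (fun x => e (gen x)) a = e (paddedLetterVal gen a) :=
    paddedLetterVal_map gen e.toMonoidHom
  have hsurj : ∀ g : K', ∃ w ∈ S.W.accepts, wordVal (fun x => e (gen x)) w = g := by
    intro g
    obtain ⟨w, hw, h⟩ := S.exists_word (e.symm g)
    exact ⟨w, hw, by rw [hval, h, e.apply_symm_apply]⟩
  exact ⟨X, hX, fun x => e (gen x), ⟨{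
    closure_range := closure_range_eq_top_of_forall_exists_word _
      fun g => (hsurj g).imp fun _ h => h.2
    WState := S.WState
    finite_WState := S.finite_WState
    W := S.W
    MState := S.MState
    finite_MState := S.finite_MState
    M := S.M
    exists_word := hsurj
    accepts_iff := fun a w x => by
      rw [S.accepts_iff, hval, hval, hval', ← map_mul, e.injective.eq_iff] }⟩⟩

/-! ### Fellow travelling coset languages -/

section Fellow

variable {X G : Type*} [Group G] (gen : X → G) (H : Subgroup G) (L : Language (X × Bool))

/-- The words `w, x ∈ L` with `w g = h x` for some `h ∈ H` have, altogether, finitely many word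
differences `w(t)⁻¹ h x(t)`. -/
def FellowTravels (g : G) : Prop :=
  ∃ D : Set G, D.Finite ∧ ∀ w ∈ L, ∀ x ∈ L, ∀ h ∈ H, wordVal gen w * g = h * wordVal gen x →
    ∀ t : ℕ, (wordVal gen (w.take t))⁻¹ * h * wordVal gen (x.take t) ∈ D

/-- A regular language that meets all cosets of `H` and whose words fellow travel. For the trivial
subgroup these are the languages of automatic structures. -/
structure IsCosetLanguage : Prop where
  isRegular : L.IsRegular
  exists_word : ∀ g : G, ∃ w ∈ L, ∃ h ∈ H, g = h * wordVal gen w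
  fellowTravels : ∀ g : G, FellowTravels gen H L g

variable {gen H L}

-- Interpose a word `y ∈ L` in the coset of `w g₁`: a difference between `w` and `x` is the product
-- of one between `w` and `y` and one between `y` and `x`.
open scoped Pointwise in
theorem FellowTravels.mul (hex : ∀ g : G, ∃ w ∈ L, ∃ h ∈ H, g = h * wordVal gen w) {g₁ g₂ : G}
    (h₁ : FellowTravels gen H L g₁) (h₂ : FellowTravels gen H L g₂) :
    FellowTravels gen H L (g₁ * g₂) := by
  obtain ⟨D₁, hD₁, hd₁⟩ := h₁
  obtain ⟨D₂, hD₂, hd₂⟩ := h₂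
  refine ⟨D₁ * D₂, hD₁.mul hD₂, fun w hw x hx h hh heq t => ?_⟩
  obtain ⟨y, hy, k, hk, hky⟩ := hex (wordVal gen w * g₁)
  refine ⟨_, hd₁ w hw y hy k hk hky t, _, hd₂ y hy x hx (k⁻¹ * h) (mul_mem (inv_mem hk) hh) ?_ t, ?_⟩
  · rw [mul_assoc, ← heq, ← mul_assoc (wordVal gen w), hky]
    group
  · group

theorem FellowTravels.inv {g : G} (hg : FellowTravels gen H L g) :
    FellowTravels gen H L g⁻¹ := by
  obtain ⟨D, hD, hd⟩ := hg
  refine ⟨D⁻¹, hD.inv, fun w hw x hx h hh heq t => ?_⟩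
  have := hd x hx w hw h⁻¹ (inv_mem hh)
    (by rw [eq_inv_mul_iff_mul_eq, ← mul_assoc, ← heq]; group) t
  rw [Set.mem_inv]
  convert! this using 1
  group

/-- The case `g = 1` is a genuine hypothesis, because `L` may contain several words for one coset.
-/
theorem fellowTravels_of_closure (hgen : Subgroup.closure (Set.range gen) = ⊤)
    (hex : ∀ g : G, ∃ w ∈ L, ∃ h ∈ H, g = h * wordVal gen w)
    (h : ∀ x, FellowTravels gen H L (gen x)) (h1 : FellowTravels gen H L 1) (g : G) :
    FellowTravels gen H L g := by
  have hg : g ∈ Subgroup.closure (Set.range gen) := hgen ▸ Subgroup.mem_top g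
  induction hg using Subgroup.closure_induction with
  | mem x hx => obtain ⟨x, rfl⟩ := hx; exact h x
  | one => exact h1
  | mul x y _ _ hx hy => exact hx.mul hex hy
  | inv x _ hx => exact hx.inv

theorem exists_finite_of_fellowTravels (h : ∀ g : G, FellowTravels gen H L g) {F : Set G}
    (hF : F.Finite) : ∃ D : Set G, D.Finite ∧ ∀ g ∈ F, ∀ w ∈ L, ∀ x ∈ L, ∀ h ∈ H,
      wordVal gen w * g = h * wordVal gen x →
        ∀ t : ℕ, (wordVal gen (w.take t))⁻¹ * h * wordVal gen (x.take t) ∈ D := by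
  choose D hD hd using h
  exact ⟨⋃ g ∈ F, D g, hF.biUnion fun g _ => hD g, fun g hg w hw x hx h hh heq t =>
    Set.mem_biUnion hg (hd g w hw x hx h hh heq t)⟩

end Fellow

/-! ### Automatic groups have the fellow traveller property -/

theorem AutomaticStructure.fellowTravels {X G : Type*} [Group G] {gen : X → G}
    (S : AutomaticStructure gen) (a : Option (X × Bool)) :
    FellowTravels gen ⊥ S.W.accepts (paddedLetterVal gen a) := by
  have := S.finite_MState a
  -- For each state, fix one continuation that leads to acceptance whenever there is any. As there
  -- are finitely many states, finitely many continuations suffice.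
  have hp : ∀ s : S.MState a, ∃ p, ∀ p', (S.M a).evalFrom s p' ∈ (S.M a).accept →
      (S.M a).evalFrom s p ∈ (S.M a).accept := by
    intro s
    by_cases h : ∃ p', (S.M a).evalFrom s p' ∈ (S.M a).accept
    · exact ⟨h.choose, fun _ _ => h.choose_spec⟩
    · exact ⟨[], fun p' hp' => absurd ⟨p', hp'⟩ h⟩
  choose p hp using hp
  refine ⟨Set.range fun s => wordVal gen (leftTape (p s)) * paddedLetterVal gen a *
    (wordVal gen (rightTape (p s)))⁻¹, Set.finite_range _, fun w hw x hx h hh heq t => ?_⟩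
  obtain rfl := Subgroup.mem_bot.1 hh
  rw [one_mul] at heq
  have hacc := (S.accepts_iff a w x).2 ⟨hw, hx, heq⟩
  rw [← List.take_append_drop t (paddedPair w x), DFA.mem_accepts, DFA.eval,
    DFA.evalFrom_of_append] at hacc
  have hacc' := hp _ _ hacc
  rw [← DFA.evalFrom_of_append] at hacc'
  -- The prefix of length `t` followed by the fixed continuation is accepted, hence is the padded
  -- pair of two words that differ by `a`. Their equation determines `w(t)⁻¹ x(t)` from the
  -- continuation alone.
  obtain ⟨w', x', hwx⟩ := S.accepts_padded a _ hacc'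
  have hl : leftTape _ = leftTape _ := congrArg leftTape hwx
  have hr : rightTape _ = rightTape _ := congrArg rightTape hwx
  rw [hwx] at hacc'
  obtain ⟨-, -, heq'⟩ := (S.accepts_iff a w' x').1 hacc'
  rw [(tapes_paddedPair w' x').1, leftTape, List.filterMap_append] at hl
  rw [(tapes_paddedPair w' x').2, rightTape, List.filterMap_append] at hr
  have hl' : (paddedPair w x |>.take t).filterMap Prod.fst = _ := (tapes_take_paddedPair w x t).1
  have hr' : (paddedPair w x |>.take t).filterMap Prod.snd = _ := (tapes_take_paddedPair w x t).2
  rw [← hl, ← hr, hl', hr', wordVal_append, wordVal_append] at heq'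
  refine ⟨(S.M a).evalFrom (S.M a).start ((paddedPair w x).take t), ?_⟩
  beta_reduce
  rw [mul_one, eq_inv_mul_iff_mul_eq, ← mul_assoc, ← mul_assoc, mul_inv_eq_iff_eq_mul]
  exact heq'

theorem AutomaticStructure.isCosetLanguage {X G : Type*} [Group G] {gen : X → G}
    (S : AutomaticStructure gen) : IsCosetLanguage gen ⊥ S.W.accepts := by
  have := S.finite_WState
  have hex : ∀ g : G, ∃ w ∈ S.W.accepts, ∃ h ∈ (⊥ : Subgroup G), g = h * wordVal gen w := by
    intro g
    obtain ⟨w, hw, rfl⟩ := S.exists_word g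
    exact ⟨w, hw, 1, one_mem _, (one_mul _).symm⟩
  exact ⟨⟨_, Fintype.ofFinite _, S.W, rfl⟩, hex, fellowTravels_of_closure S.closure_range hex
    (fun x => S.fellowTravels (some (x, true))) (S.fellowTravels none)⟩

/-! ### Strong automatic coset systems -/

theorem exists_list_of_mem_subgroupClosure {G : Type*} [Group G] {Y : Set G} {g : G}
    (hg : g ∈ Subgroup.closure Y) :
    ∃ l : List G, (∀ b ∈ l, b ∈ Y ∨ b⁻¹ ∈ Y) ∧ l.prod = g := by
  rw [← Subgroup.mem_toSubmonoid, Subgroup.closure_toSubmonoid] at hg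
  exact Submonoid.exists_list_of_mem_closure hg

theorem finite_setOf_wordLength_le {X G : Type*} [Finite X] [Group G] {gen : X → G}
    (hgen : Subgroup.closure (Set.range gen) = ⊤) (k : ℕ) :
    {g : G | wordLength gen g ≤ k}.Finite := by
  have hfin : {w : List (X × Bool) | w.length ≤ k}.Finite := List.finite_length_le _ k
  refine (hfin.image (wordVal gen)).subset fun g hg => ?_
  -- The infimum must be attained: over an empty set it would be `0` and would bound nothing.
  have hne : {n : ℕ | ∃ w : List (X × Bool), w.length = n ∧ wordVal gen w = g}.Nonempty := by
    have hg' : g ∈ Subgroup.closure (Set.range gen) := hgen ▸ Subgroup.mem_top g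
    obtain ⟨l, hl, rfl⟩ := exists_list_of_mem_subgroupClosure hg'
    suffices ∃ w, wordVal gen w = l.prod from this.elim fun w hw => ⟨_, w, rfl, hw⟩
    clear hg hg'
    induction l with
    | nil => exact ⟨[], rfl⟩
    | cons a l ih =>
      obtain ⟨w, hw⟩ := ih fun x hx => hl x (by simp [hx])
      rcases hl a (by simp) with ⟨x, hx⟩ | ⟨x, hx⟩
      · exact ⟨(x, true) :: w, by simp [letterVal, hx, hw]⟩
      · exact ⟨(x, false) :: w, by simp [letterVal, hx, hw]⟩
  obtain ⟨w, hw, hwg⟩ := Nat.sInf_mem hne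
  exact ⟨w, hw.trans_le hg, hwg⟩

theorem rightCoset_eq_of_eq_mul {G : Type*} [Group G] {H : Subgroup G} {g g' h : G} (hh : h ∈ H)
    (heq : g = h * g') : rightCoset H g = rightCoset H g' := by
  subst heq
  ext k
  constructor
  · rintro ⟨h', hh', rfl⟩
    exact ⟨h' * h, mul_mem hh' hh, by group⟩
  · rintro ⟨h', hh', rfl⟩
    exact ⟨h' * h⁻¹, mul_mem hh' (inv_mem hh), by group⟩

theorem AutomaticCosetSystem.isCosetLanguage {X G : Type*} [Finite X] [Group G] {gen : X → G}
    {H : Subgroup G} (C : AutomaticCosetSystem gen H) (hC : C.IsStrong) :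
    IsCosetLanguage gen H C.W.accepts := by
  have := C.finite_WState
  have hex : ∀ g : G, ∃ w ∈ C.W.accepts, ∃ h ∈ H, g = h * wordVal gen w := by
    intro g
    obtain ⟨w, hw, h, hh, heq⟩ := C.exists_word g
    exact ⟨w, hw, h⁻¹, inv_mem hh, by rw [heq]; group⟩
  obtain ⟨k, hk⟩ := hC
  have hlet : ∀ x, FellowTravels gen H C.W.accepts (gen x) := fun x =>
    ⟨_, finite_setOf_wordLength_le C.closure_range k, fun w hw y hy h hh heq t =>
      hk (x, true) w y ((C.accepts_iff _ _ _).2 ⟨hw, hy, rightCoset_eq_of_eq_mul hh heq⟩)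
        h hh heq t⟩
  refine ⟨⟨_, Fintype.ofFinite _, C.W, rfl⟩, hex,
    fellowTravels_of_closure C.closure_range hex hlet ?_⟩
  -- Strength concerns only the letters of `A`, so `1` is written as `x x⁻¹`; without generators the
  -- group is trivial.
  rcases isEmpty_or_nonempty X with hX | ⟨⟨x⟩⟩
  · have : (⊤ : Subgroup G) = ⊥ := by
      rw [← C.closure_range, Set.range_eq_empty, Subgroup.closure_empty]
    have : ∀ g : G, g = 1 := fun g => Subgroup.mem_bot.1 (this ▸ Subgroup.mem_top g)
    exact ⟨{1}, Set.finite_singleton 1, fun _ _ _ _ _ _ _ _ => this _⟩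
  · simpa using (hlet x).mul hex (hlet x).inv

/-- This allows an index type of generators from an arbitrary universe to be replaced by some `Fin
n`. -/
theorem IsCosetLanguage.relabel {X X' G : Type*} [Group G] {gen : X → G} {H : Subgroup G}
    {L : Language (X × Bool)} (hL : IsCosetLanguage gen H L) (e : X' ≃ X) :
    IsCosetLanguage (gen ∘ e) H ({w | w.map (Prod.map e id) ∈ L} : Language (X' × Bool)) where
  isRegular := hL.isRegular.preimage_map _
  exists_word g := by
    obtain ⟨w, hw, h, hh, heq⟩ := hL.exists_word g
    have : (w.map (Prod.map e.symm id)).map (Prod.map e id) = w := by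
      simp [Function.comp_def, Prod.map]
    refine ⟨w.map (Prod.map e.symm id), ?_, h, hh, ?_⟩
    · change List.map _ _ ∈ L
      rwa [this]
    · rwa [← wordVal_relabel, this]
  fellowTravels g := by
    obtain ⟨D, hD, hd⟩ := hL.fellowTravels g
    refine ⟨D, hD, fun w hw x hx h hh heq t => ?_⟩
    rw [← wordVal_relabel, ← wordVal_relabel] at heq ⊢
    rw [List.map_take, List.map_take]
    exact hd _ hw _ hx h hh heq t

/-! ### Efficient generators -/

section Efficient

variable {X G : Type*} [Group G] {gen : X → G} {H : Subgroup G} {L : Language (X × Bool)}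

/-- The elements of length at most `m` with respect to the generators `Y`. -/
def generatorBall (Y : Set H) (m : ℕ) : Set H :=
  {h | ∃ l : List H, (∀ b ∈ l, b ∈ Y ∨ b⁻¹ ∈ Y) ∧ l.length ≤ m ∧ l.prod = h}

open scoped Pointwise in
theorem finite_generatorBall {Y : Set H} (hY : Y.Finite) (m : ℕ) : (generatorBall Y m).Finite := by
  induction m with
  | zero =>
    refine (Set.finite_singleton 1).subset ?_
    rintro _ ⟨l, -, hl, rfl⟩
    simp [List.length_eq_zero_iff.1 (Nat.le_zero.1 hl)]
  | succ m ih =>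
    refine (((hY.union hY.inv).mul ih).insert 1).subset ?_
    rintro _ ⟨l, hb, hl, rfl⟩
    cases l with
    | nil => exact Set.mem_insert _ _
    | cons b l =>
      refine Set.mem_insert_of_mem _ ⟨b, hb b (by simp), l.prod, ⟨l, fun c hc => hb c (by simp [hc]),
        by simpa using hl, rfl⟩, by simp⟩

theorem generatorBall_mono (Y : Set H) {m n : ℕ} (h : m ≤ n) :
    generatorBall Y m ⊆ generatorBall Y n :=
  fun _ ⟨l, hb, hl, hp⟩ => ⟨l, hb, hl.trans h, hp⟩

theorem exists_subset_generatorBall {Y E : Set H} (hY : Subgroup.closure Y = ⊤) (hE : E.Finite) :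
    ∃ m, E ⊆ generatorBall Y m := by
  have hlist : ∀ h : H, ∃ l : List H, (∀ b ∈ l, b ∈ Y ∨ b⁻¹ ∈ Y) ∧ l.prod = h := fun h =>
    exists_list_of_mem_subgroupClosure (hY ▸ Subgroup.mem_top h)
  choose l hb hl using hlist
  obtain ⟨m, hm⟩ := (hE.image fun h => (l h).length).bddAbove
  exact ⟨m, fun h hh => ⟨l h, hb h, hm ⟨h, hh, rfl⟩, hl h⟩⟩

theorem map_mem_generatorBall {Y : Set H} {α : H ≃* H} (hα : ∀ y ∈ Y, α y ∈ Y) {m : ℕ} {h : H}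
    (hh : h ∈ generatorBall Y m) : α h ∈ generatorBall Y m := by
  obtain ⟨l, hb, hl, rfl⟩ := hh
  refine ⟨l.map α, ?_, by simpa using hl, by simp [map_list_prod]⟩
  intro b hb'
  obtain ⟨c, hc, rfl⟩ := List.mem_map.1 hb'
  exact (hb c hc).imp (hα _) fun h => by rw [← map_inv]; exact hα _ h

variable (hex : ∀ g : G, ∃ w ∈ L, ∃ h ∈ H, g = h * wordVal gen w) {Y : Set H}
  (heff : ∀ w ∈ L, ∀ x ∈ L, ∀ b h : H, (b ∈ Y ∨ b⁻¹ ∈ Y) →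
    wordVal gen w * (b : G) = (h : G) * wordVal gen x → h = 1 ∨ h ∈ Y ∨ h⁻¹ ∈ Y)
include hex heff

/-- Choose a word of `L` in the coset reached after each letter. Efficiency lets each letter
contribute at most one letter to `h`, so the length does not grow. -/
theorem mem_generatorBall_length_of_mul_eq {l : List H} (hl : l ≠ [])
    (hb : ∀ b ∈ l, b ∈ Y ∨ b⁻¹ ∈ Y) {w x : List (X × Bool)} (hw : w ∈ L) (hx : x ∈ L) {h : H}
    (heq : wordVal gen w * (l.prod : H) = h * wordVal gen x) : h ∈ generatorBall Y l.length := by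
  induction l generalizing w h with
  | nil => exact absurd rfl hl
  | cons b l ih =>
    have step : ∀ {h : H} {y : List (X × Bool)}, y ∈ L →
        wordVal gen w * (b : G) = h * wordVal gen y → h ∈ generatorBall Y 1 := by
      intro h y hy heq
      rcases heff w hw y hy b h (hb b (by simp)) heq with rfl | hh
      · exact ⟨[], by simp, by simp, rfl⟩
      · exact ⟨[h], by simpa using hh, by simp, by simp⟩
    rcases eq_or_ne l [] with rfl | hne
    · exact step hx (by simpa using heq)
    · obtain ⟨y, hy, k, hk, hky⟩ := hex (wordVal gen w * b)
      obtain ⟨l₁, hb₁, hl₁, hp₁⟩ := step (h := ⟨k, hk⟩) hy hky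
      obtain ⟨l₂, hb₂, hl₂, hp₂⟩ := ih hne (fun c hc => hb c (by simp [hc])) hy
        (h := ⟨k, hk⟩⁻¹ * h) (by
          rw [List.prod_cons, Subgroup.coe_mul, ← mul_assoc, hky] at heq
          rw [Subgroup.coe_mul, mul_assoc, ← heq]
          simp [mul_assoc])
      refine ⟨l₁ ++ l₂, ?_, ?_, ?_⟩
      · intro c hc
        exact (List.mem_append.1 hc).elim (hb₁ c) (hb₂ c)
      · simp only [List.length_append, List.length_cons]; omega
      · rw [List.prod_append, hp₁, hp₂]; group

/-- For `h = 1` the element `h'` need not be trivial, as `w` and `x` may be different words for one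
coset. Writing `1` as `y y⁻¹` bounds its length by two, which is why `2 ≤ m` is required. -/
theorem mem_generatorBall_of_mul_eq (hY : Subgroup.closure Y = ⊤) {m : ℕ} (hm : 2 ≤ m) {h : H}
    (hh : h ∈ generatorBall Y m) {w x : List (X × Bool)} (hw : w ∈ L) (hx : x ∈ L) {h' : H}
    (heq : wordVal gen w * (h : G) = h' * wordVal gen x) : h' ∈ generatorBall Y m := by
  obtain ⟨l, hb, hl, rfl⟩ := hh
  rcases eq_or_ne l [] with rfl | hne
  · rcases Y.eq_empty_or_nonempty with rfl | ⟨y, hy⟩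
    · rw [Subgroup.closure_empty] at hY
      have : h' = 1 := Subgroup.mem_bot.1 (hY ▸ Subgroup.mem_top h')
      exact ⟨[], by simp, by simp, this.symm⟩
    · refine generatorBall_mono Y hm (mem_generatorBall_length_of_mul_eq hex heff
        (l := [y, y⁻¹]) (by simp) (by simp [hy]) hw hx ?_)
      simpa using heq
  · exact generatorBall_mono Y hl (mem_generatorBall_length_of_mul_eq hex heff hne hb hw hx heq)

/-- A ball over `Y` of radius at least two is stable under `α`, under its inverse and under crossing
a syllable. Hence the element carried through a word does not leave it, however long the word is. -/
theorem exists_finite_invariant (hYfin : Y.Finite) (hY : Subgroup.closure Y = ⊤) {α : H ≃* H}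
    (hα : α '' Y = Y) {E : Set H} (hE : E.Finite) :
    ∃ F : Set H, F.Finite ∧ E ⊆ F ∧ (∀ h ∈ F, α h ∈ F) ∧ (∀ h ∈ F, α.symm h ∈ F) ∧
      ∀ w ∈ L, ∀ x ∈ L, ∀ h ∈ F, ∀ h' : H,
        wordVal gen w * (h : G) = h' * wordVal gen x → h' ∈ F := by
  obtain ⟨m, hm⟩ := exists_subset_generatorBall hY hE
  refine ⟨generatorBall Y (m + 2), finite_generatorBall hYfin _,
    hm.trans (generatorBall_mono Y (by omega)), fun h hh => ?_, fun h hh => ?_,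
    fun w hw x hx h hh h' heq => mem_generatorBall_of_mul_eq hex heff hY (by omega) hh hw hx heq⟩
  · exact map_mem_generatorBall (fun y hy => hα ▸ Set.mem_image_of_mem α hy) hh
  · refine map_mem_generatorBall (fun y hy => ?_) hh
    rw [← hα] at hy
    obtain ⟨z, hz, rfl⟩ := hy
    simpa using hz

end Efficient

/-! ### Reduced words in an HNN extension -/

namespace HNNExtension

section Reduced

variable {G : Type*} [Group G] {H : Subgroup G} (φ : H ≃* H)

/-- The stable letter or its inverse. -/
def stableLetter (e : Bool) : HNNExtension G H H φ := if e then t else t⁻¹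

/-- The automorphism of `H` that is induced by conjugation with `stableLetter φ e`. -/
def stableConj (e : Bool) : H ≃* H := if e then φ else φ.symm

theorem stableLetter_not (e : Bool) : stableLetter φ (!e) = (stableLetter φ e)⁻¹ := by
  cases e <;> simp [stableLetter]

theorem stableLetter_mul_of (e : Bool) (h : H) :
    stableLetter φ e * of (h : G) = of (stableConj φ e h : G) * stableLetter φ e := by
  cases e
  · exact inv_t_mul_of h
  · exact t_mul_of h

/-- The product of the elements `z^e g` for the members `(e, g)` of a list. -/
def stableProd (l : List (Bool × G)) : HNNExtension G H H φ :=
  (l.map fun x => stableLetter φ x.1 * of x.2).prod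

@[simp]
theorem stableProd_nil : stableProd φ [] = 1 := rfl

@[simp]
theorem stableProd_cons (x : Bool × G) (l : List (Bool × G)) :
    stableProd φ (x :: l) = stableLetter φ x.1 * of x.2 * stableProd φ l := by
  simp [stableProd]

@[simp]
theorem stableProd_append (l l' : List (Bool × G)) :
    stableProd φ (l ++ l') = stableProd φ l * stableProd φ l' := by
  simp [stableProd]

variable (H) in
/-- There is no part `z^e h z^{-e}` with `h ∈ H`. -/
def IsStableReduced (l : List (Bool × G)) : Prop := l.IsChain fun a b => a.2 ∈ H → a.1 = b.1

/-- The sign of a letter, as a unit of `ℤ`. -/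
def boolSign (e : Bool) : ℤˣ := if e then 1 else -1

theorem boolSign_injective : Function.Injective boolSign := by
  intro a b h
  cases a <;> cases b <;> simp_all [boolSign]

theorem toSubgroup_self (u : ℤˣ) : toSubgroup H H u = H := by simp [toSubgroup]

/-- A reduced list, with a head, as a reduced word in the sense of Mathlib. -/
def IsStableReduced.toReducedWord {l : List (Bool × G)} (hl : IsStableReduced H l) (g : G) :
    NormalWord.ReducedWord G H H where
  head := g
  toList := l.map (Prod.map boolSign id)
  chain := by
    rw [List.isChain_map]
    refine List.IsChain.imp ?_ hl
    intro a b h ha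
    rw [toSubgroup_self] at ha
    exact congrArg boolSign (h ha)

theorem IsStableReduced.prod_toReducedWord {l : List (Bool × G)} (hl : IsStableReduced H l) (g : G) :
    (hl.toReducedWord g).prod φ = of g * stableProd φ l := by
  simp only [NormalWord.ReducedWord.prod, toReducedWord, stableProd, List.map_map]
  congr 3
  ext ⟨e, a⟩
  cases e <;> simp [boolSign, stableLetter]

variable {φ}

theorem britton {l l' : List (Bool × G)} (hl : IsStableReduced H l) (hl' : IsStableReduced H l') {g g' : G}
    (heq : of g * stableProd φ l = of g' * stableProd φ l') :
    l.map Prod.fst = l'.map Prod.fst ∧ (l ≠ [] → g⁻¹ * g' ∈ H) := by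
  have h := ReducedWord.map_fst_eq_and_of_prod_eq φ (w₁ := hl.toReducedWord g)
    (w₂ := hl'.toReducedWord g')
    (by rw [hl.prod_toReducedWord, hl'.prod_toReducedWord, heq])
  refine ⟨?_, fun hne => ?_⟩
  · have h1 := h.1
    simp only [IsStableReduced.toReducedWord, List.map_map] at h1
    refine List.map_injective_iff.2 boolSign_injective ?_
    simpa [Function.comp_def] using h1
  · obtain ⟨x, l, rfl⟩ := List.exists_cons_of_ne_nil hne
    have h2 := h.2 (boolSign x.1) (by simp [IsStableReduced.toReducedWord])
    rwa [toSubgroup_self] at h2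

/-- The last group element of a list is followed by no stable letter, so reducedness does not
restrict it. A right factor from `G` can therefore be absorbed there. -/
theorem IsStableReduced.append_last {l : List (Bool × G)} {e : Bool} {a : G}
    (hl : IsStableReduced H (l ++ [(e, a)])) (b : G) : IsStableReduced H (l ++ [(e, b)]) := by
  rw [IsStableReduced, List.isChain_append] at hl ⊢
  refine ⟨hl.1, List.isChain_singleton _, fun x hx y hy => ?_⟩
  have := hl.2.2 x hx (e, a) (by simp)
  simp only [List.head?_cons, Option.mem_def, Option.some.injEq] at hy
  subst hy
  exact this

theorem britton_mul_right {l l' : List (Bool × G)} (hl : IsStableReduced H l) (hl' : IsStableReduced H l')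
    {a a' g : G} (heq : of a * stableProd φ l * of g = of a' * stableProd φ l') :
    l.map Prod.fst = l'.map Prod.fst ∧ (l ≠ [] → a⁻¹ * a' ∈ H) := by
  rcases List.eq_nil_or_concat' l with rfl | ⟨l, ⟨e, b⟩, rfl⟩
  · refine ⟨(britton (φ := φ) hl hl' (g := a * g) (g' := a') ?_).1, by simp⟩
    simpa using heq
  · have := britton (φ := φ) (hl.append_last (b * g)) hl' (g := a) (g' := a')
      (by rw [← heq]; simp [mul_assoc])
    simpa using this

theorem britton_nil_mul_right {l' : List (Bool × G)} (hl' : IsStableReduced H l')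
    {a a' g : G} (heq : of a * of g = of a' * stableProd φ l') : l' = [] ∧ a * g = a' := by
  have h := (britton_mul_right (φ := φ) (l := []) List.isChain_nil hl' (a := a) (a' := a') (g := g)
    (by simpa using heq)).1
  obtain rfl : l' = [] := List.map_eq_nil_iff.1 h.symm
  refine ⟨rfl, of_injective (φ := φ) ?_⟩
  simpa using heq

/-- Britton's lemma puts `a⁻¹ a'` into `H`. Moving it through the first stable letter and cancelling
gives an equation of the same shape with one syllable fewer, which is what an induction along the
word needs. -/
theorem britton_cons_mul_right {l l' : List (Bool × G)} {x : Bool × G}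
    (hl : IsStableReduced H (x :: l)) (hl' : IsStableReduced H l') {a a' g : G}
    (heq : of a * stableProd φ (x :: l) * of g = of a' * stableProd φ l') :
    ∃ b l'', l' = (x.1, b) :: l'' ∧ ∃ k : H, a * stableConj φ x.1 k = a' ∧
      of x.2 * stableProd φ l * of g = of (k : G) * (of b * stableProd φ l'') := by
  obtain ⟨h1, h2⟩ := britton_mul_right hl hl' heq
  cases l' with
  | nil => simp at h1
  | cons y l' =>
    obtain ⟨e, c⟩ := x
    obtain ⟨e', b⟩ := y
    simp only [List.map_cons, List.cons.injEq] at h1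
    obtain ⟨rfl, -⟩ := h1
    refine ⟨b, l', rfl, (stableConj φ e).symm ⟨_, h2 (by simp)⟩, by simp, ?_⟩
    set k := (stableConj φ e).symm ⟨a⁻¹ * a', h2 (by simp)⟩ with hk
    have ha : a' = a * stableConj φ e k := by simp [hk]
    rw [ha, stableProd_cons, stableProd_cons] at heq
    have h3 := stableLetter_mul_of φ e k
    have h4 : of a * stableLetter φ e * (of c * stableProd φ l * of g) =
        of a * stableLetter φ e * (of (k : G) * (of b * stableProd φ l')) := by
      calc _ = of a * (stableLetter φ e * of c * stableProd φ l) * of g := by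
            simp only [mul_assoc]
        _ = of a * (of (stableConj φ e k : G) * stableLetter φ e) * (of b * stableProd φ l') := by
          rw [heq, map_mul]; simp only [mul_assoc]
        _ = _ := by rw [← h3]; simp only [mul_assoc]
    exact mul_left_cancel h4

theorem exists_reduced (k : HNNExtension G H H φ) :
    ∃ (g : G) (l : List (Bool × G)), IsStableReduced H l ∧ k = of g * stableProd φ l := by
  obtain ⟨d⟩ := NormalWord.TransversalPair.nonempty G H H
  obtain ⟨w, rfl⟩ := (NormalWord.equiv φ d).symm.surjective k
  refine ⟨w.head, w.toList.map fun x => (decide (x.1 = 1), x.2), ?_, ?_⟩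
  · rw [IsStableReduced, List.isChain_map]
    refine List.IsChain.imp ?_ w.chain
    intro a b h ha
    simp only at ha ⊢
    rw [h (by rwa [toSubgroup_self])]
  · change of w.head * _ = _
    rw [stableProd, List.map_map]
    congr 3
    ext ⟨u, a⟩
    rcases Int.units_eq_one_or u with rfl | rfl <;> simp [stableLetter]

end Reduced

end HNNExtension

/-! ### Words for the elements of an HNN extension -/

/-- Generators of an HNN extension: generators of the associated subgroup, generators of the base
group, the stable letter, and a separating symbol that maps to the identity. -/
inductive HNNGenerator (U V : Type)
  | sub (u : U)
  | base (v : V)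
  | stable
  | sep

namespace HNNGenerator

variable {U V : Type}

instance [Finite U] [Finite V] : Finite (HNNGenerator U V) := by
  refine Finite.of_injective (β := U ⊕ V ⊕ Bool) (fun x => match x with
    | sub u => .inl u
    | base v => .inr (.inl v)
    | stable => .inr (.inr true)
    | sep => .inr (.inr false)) ?_
  intro x y h
  cases x <;> cases y <;> simp_all

/-- The letters at which the two tapes are synchronised. -/
def isDelimiter : HNNGenerator U V × Bool → Bool
  | (sub _, _) => false
  | (base _, _) => false
  | (stable, _) => true
  | (sep, _) => true

/-- A word in the generators of the associated subgroup. -/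
def subWord (v : List (U × Bool)) : List (HNNGenerator U V × Bool) := v.map (Prod.map sub id)

/-- A word in the generators of the base group. -/
def baseWord (w : List (V × Bool)) : List (HNNGenerator U V × Bool) := w.map (Prod.map base id)

/-- The word `z^{e₁} w₁ z^{e₂} w₂ …`. -/
def tailWord : List (Bool × List (V × Bool)) → List (HNNGenerator U V × Bool)
  | [] => []
  | x :: l => (stable, x.1) :: (baseWord x.2 ++ tailWord l)

/-- The word `v $ w z^{e₁} w₁ z^{e₂} w₂ …`. -/
def hnnWord (v : List (U × Bool)) (w : List (V × Bool)) (l : List (Bool × List (V × Bool))) :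
    List (HNNGenerator U V × Bool) :=
  subWord v ++ (sep, true) :: (baseWord w ++ tailWord l)

theorem isDelimiter_subWord (v : List (U × Bool)) :
    ∀ a ∈ (subWord v : List (HNNGenerator U V × Bool)), isDelimiter a = false := by
  intro a ha
  obtain ⟨b, -, rfl⟩ := List.mem_map.1 ha
  rfl

theorem isDelimiter_baseWord (w : List (V × Bool)) :
    ∀ a ∈ (baseWord w : List (HNNGenerator U V × Bool)), isDelimiter a = false := by
  intro a ha
  obtain ⟨b, -, rfl⟩ := List.mem_map.1 ha
  rfl

theorem tailWord_append (l l' : List (Bool × List (V × Bool))) :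
    (tailWord (l ++ l') : List (HNNGenerator U V × Bool)) = tailWord l ++ tailWord l' := by
  induction l with
  | nil => rfl
  | cons x l ih => simp [tailWord, ih]

end HNNGenerator

open HNNExtension HNNGenerator

section Values

variable {G : Type*} [Group G] {H : Subgroup G} (φ : H ≃* H) {U V : Type} (genH : U → H)
  (genG : V → G)

/-- The elements onto which the generators of the HNN extension map. -/
def hnnGen : HNNGenerator U V → HNNExtension G H H φ
  | sub u => of (genH u : G)
  | base v => of (genG v)
  | stable => t
  | sep => 1

/-- The list of group elements `(e, g)` for a list of words `(e, w)`. -/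
def valList (l : List (Bool × List (V × Bool))) : List (Bool × G) :=
  l.map (Prod.map id (wordVal genG))

@[simp]
theorem valList_nil : valList genG [] = [] := rfl

@[simp]
theorem valList_cons (x : Bool × List (V × Bool)) (l : List (Bool × List (V × Bool))) :
    valList genG (x :: l) = (x.1, wordVal genG x.2) :: valList genG l := rfl

@[simp]
theorem wordVal_subWord (v : List (U × Bool)) :
    wordVal (hnnGen φ genH genG) (subWord v) = of ((wordVal genH v : H) : G) :=
  (wordVal_relabel _ _ _).trans
    (wordVal_map genH ((of : G →* HNNExtension G H H φ).comp H.subtype) v)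

@[simp]
theorem wordVal_baseWord (w : List (V × Bool)) :
    wordVal (hnnGen φ genH genG) (baseWord w) = of (wordVal genG w) :=
  (wordVal_relabel _ _ _).trans (wordVal_map genG (of : G →* HNNExtension G H H φ) w)

@[simp]
theorem letterVal_stable (e : Bool) :
    letterVal (hnnGen φ genH genG) (stable, e) = stableLetter φ e := rfl

@[simp]
theorem letterVal_sep (e : Bool) : letterVal (hnnGen φ genH genG) (sep, e) = 1 := by
  simp [letterVal, hnnGen]

@[simp]
theorem wordVal_tailWord (l : List (Bool × List (V × Bool))) :
    wordVal (hnnGen φ genH genG) (tailWord l) = stableProd φ (valList genG l) := by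
  induction l with
  | nil => rfl
  | cons x l ih => simp [tailWord, ih, mul_assoc]

@[simp]
theorem wordVal_hnnWord (v : List (U × Bool)) (w : List (V × Bool))
    (l : List (Bool × List (V × Bool))) : wordVal (hnnGen φ genH genG) (hnnWord v w l) =
      of ((wordVal genH v : H) : G) * (of (wordVal genG w) * stableProd φ (valList genG l)) := by
  simp [hnnWord]

end Values

section Language

variable {G : Type*} [Group G] (H : Subgroup G) {U V : Type} (genG : V → G)
  (LH : Language (U × Bool)) (L : Language (V × Bool))

/-- The words `v $ w z^{e₁} w₁ z^{e₂} w₂ …` without cancellation. -/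
def hnnLanguage : Language (HNNGenerator U V × Bool) :=
  {u | ∃ v ∈ LH, ∃ w ∈ L, ∃ l : List (Bool × List (V × Bool)), (∀ x ∈ l, x.2 ∈ L) ∧
    IsStableReduced H (valList genG l) ∧ u = hnnWord v w l}

variable {H genG LH L}

/-- Representatives are chosen from right to left, and the factor from `H` moves left through the
stable letter into the next syllable. Membership in `H` and the sign of the first stable letter are
carried along because the new list must again be reduced. -/
theorem exists_valList (φ : H ≃* H)
    (hex : ∀ g : G, ∃ w ∈ L, ∃ h ∈ H, g = h * wordVal genG w) (g : G) {l : List (Bool × G)}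
    (hl : IsStableReduced H l) : ∃ h : H, ∃ w ∈ L, (wordVal genG w ∈ H ↔ g ∈ H) ∧
      ∃ l' : List (Bool × List (V × Bool)), (∀ x ∈ l', x.2 ∈ L) ∧
        IsStableReduced H (valList genG l') ∧ l'.head?.map Prod.fst = l.head?.map Prod.fst ∧
        of g * stableProd φ l = of (h : G) * (of (wordVal genG w) * stableProd φ (valList genG l')) := by
  have hcoset : ∀ g : G, ∃ h : H, ∃ w ∈ L, (wordVal genG w ∈ H ↔ g ∈ H) ∧
      g = h * wordVal genG w := by
    intro g
    obtain ⟨w, hw, h, hh, rfl⟩ := hex g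
    exact ⟨⟨h, hh⟩, w, hw, (Subgroup.mul_mem_cancel_left H hh).symm, rfl⟩
  induction l generalizing g with
  | nil =>
    obtain ⟨h, w, hw, hiff, heq⟩ := hcoset g
    refine ⟨h, w, hw, hiff, [], by simp, List.isChain_nil, rfl, ?_⟩
    conv_lhs => rw [heq]
    simp
  | cons x l ih =>
    obtain ⟨e, a⟩ := x
    have hl' := List.isChain_cons.1 hl
    obtain ⟨k, w, hw, hiff, l', hl1, hl2, hhead, heq⟩ := ih a hl'.2
    obtain ⟨h, y, hy, hyiff, hgy⟩ := hcoset (g * stableConj φ e k)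
    refine ⟨h, y, hy, ?_, (e, w) :: l', ?_, ?_, rfl, ?_⟩
    · rw [hyiff, Subgroup.mul_mem_cancel_right H (stableConj φ e k).2]
    · exact List.forall_mem_cons.2 ⟨hw, hl1⟩
    · rw [valList_cons, IsStableReduced, List.isChain_cons]
      refine ⟨fun b hb hwH => ?_, hl2⟩
      have hb' : (l.head?.map Prod.fst) = some b.1 := by
        rw [← hhead]
        cases l' with
        | nil => simp at hb
        | cons c l' =>
          simp only [valList_cons, List.head?_cons, Option.mem_def, Option.some.injEq] at hb
          simp [← hb]
      obtain ⟨c, hc, hcb⟩ := Option.map_eq_some_iff.1 hb'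
      rw [← hcb]
      exact hl'.1 c hc (hiff.1 hwH)
    · rw [stableProd_cons, valList_cons, stableProd_cons]
      calc _ = of g * stableLetter φ e * (of a * stableProd φ l) := by simp only [mul_assoc]
        _ = of g * (stableLetter φ e * of (k : G)) *
            (of (wordVal genG w) * stableProd φ (valList genG l')) := by
          rw [heq]; simp only [mul_assoc]
        _ = of (g * stableConj φ e k) * stableLetter φ e *
            (of (wordVal genG w) * stableProd φ (valList genG l')) := by
          rw [stableLetter_mul_of, map_mul]; simp only [mul_assoc]
        _ = _ := by rw [hgy, map_mul]; simp only [mul_assoc]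

theorem exists_mem_hnnLanguage (φ : H ≃* H) {genH : U → H}
    (hexH : ∀ h : H, ∃ v ∈ LH, wordVal genH v = h)
    (hex : ∀ g : G, ∃ w ∈ L, ∃ h ∈ H, g = h * wordVal genG w) (k : HNNExtension G H H φ) :
    ∃ u ∈ hnnLanguage H genG LH L, wordVal (hnnGen φ genH genG) u = k := by
  obtain ⟨g, l, hl, rfl⟩ := exists_reduced k
  obtain ⟨h, w, hw, -, l', hl1, hl2, -, heq⟩ := exists_valList φ hex g hl
  obtain ⟨v, hv, rfl⟩ := hexH h
  exact ⟨_, ⟨v, hv, w, hw, l', hl1, hl2, rfl⟩, by rw [wordVal_hnnWord, heq]⟩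

end Language

/-! ### Regularity of the language of the HNN extension -/

section PrefixValues

variable {X G : Type*} [Group G] {gen : X → G} {H : Subgroup G} {L : Language (X × Bool)}

-- All these words `w` lie in the coset `H`, so they fellow travel with one fixed word `x` for it.
-- The linking element `h = x w⁻¹` is the difference at `t = 0`, hence takes finitely many values,
-- and `w(t) = h⁻¹ x(t) d` with `d` a difference.
open scoped Pointwise in
theorem IsCosetLanguage.finite_prefix_values (hL : IsCosetLanguage gen H L) :
    {n : G | ∃ w ∈ L, wordVal gen w ∈ H ∧ ∃ t : ℕ, n = wordVal gen (w.take t)}.Finite := by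
  obtain ⟨D, hD, hd⟩ := hL.fellowTravels 1
  obtain ⟨x, hx, h, hh, heq⟩ := hL.exists_word 1
  have hxH : wordVal gen x ∈ H := by
    rw [← inv_eq_of_mul_eq_one_right heq.symm]; exact inv_mem hh
  have hfin : {n : G | ∃ t : ℕ, n = wordVal gen (x.take t)}.Finite := by
    refine ((List.finite_toSet x.inits).image (wordVal gen)).subset ?_
    rintro _ ⟨t, rfl⟩
    exact ⟨_, (List.mem_inits _ _).2 (List.take_prefix t x), rfl⟩
  refine ((hD.inv.mul hfin).mul hD).subset ?_
  rintro _ ⟨w, hw, hwH, t, rfl⟩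
  have key := hd x hx w hw (wordVal gen x * (wordVal gen w)⁻¹) (mul_mem hxH (inv_mem hwH))
    (by group)
  have h0 : wordVal gen x * (wordVal gen w)⁻¹ ∈ D := by simpa using key 0
  exact ⟨_, ⟨_, Set.inv_mem_inv.2 h0, _, ⟨t, rfl⟩, rfl⟩, _, key t, by group⟩

/-- An automaton can compute the value of the prefix read so far: for the words in question it stays
in a finite set. -/
theorem IsCosetLanguage.isRegular_inter (hL : IsCosetLanguage gen H L) :
    Language.IsRegular ({w | w ∈ L ∧ wordVal gen w ∈ H} : Language (X × Bool)) := by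
  have hfold : ∀ w : List (X × Bool),
      w.foldl (fun d a => d * letterVal gen a) 1 = wordVal gen w := by
    intro w
    induction w using List.reverseRecOn with
    | nil => rfl
    | append_singleton w a ih => rw [List.foldl_append, ih]; simp
  have h := hL.isRegular.inf (Language.isRegular_of_finite_track
    (fun d (a : X × Bool) => d * letterVal gen a) 1 hL.finite_prefix_values (H : Set G))
  refine (congrArg Language.IsRegular (Set.ext fun w => ?_)).mp h
  constructor
  · rintro ⟨hw, -, hwH⟩
    exact ⟨hw, by rw [hfold] at hwH; exact hwH⟩
  · rintro ⟨hw, hwH⟩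
    refine ⟨hw, fun p hp => ?_, ?_⟩
    · rw [hfold]
      exact ⟨w, hw, hwH, p.length, by rw [← List.prefix_iff_eq_take.1 hp]⟩
    · rw [hfold]; exact hwH

end PrefixValues

section Regular

variable {U V : Type} {σ τ ρ : Type}

open scoped Classical in
/-- The automaton for `hnnLanguage`, where `W`, `A` and `B` accept the languages of the words `v`,
the words `w`, and the words `w` with values in the subgroup. In its second phase it remembers
the last sign. -/
noncomputable def hnnDFA (W : DFA (U × Bool) σ) (A : DFA (V × Bool) τ) (B : DFA (V × Bool) ρ) :
    DFA (HNNGenerator U V × Bool) (Option (σ ⊕ τ × ρ × Option Bool)) where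
  step
    | some (.inl q), (sub u, b) => some (.inl (W.step q (u, b)))
    | some (.inl q), (sep, true) =>
      if q ∈ W.accept then some (.inr (A.start, B.start, none)) else none
    | some (.inr (q, r, e)), (base v, b) => some (.inr (A.step q (v, b), B.step r (v, b), e))
    | some (.inr (q, r, e)), (stable, f) =>
      -- In the head block `e = none`, so the sign condition is empty there: a value in `H` before
      -- the first stable letter is harmless.
      if q ∈ A.accept ∧ (r ∈ B.accept → ∀ e' ∈ e, e' = f) then
        some (.inr (A.start, B.start, some f)) else none
    | _, _ => none
  start := some (.inl W.start)
  accept := {s | ∃ q r e, s = some (.inr (q, r, e)) ∧ q ∈ A.accept}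

variable {G : Type*} [Group G] {H : Subgroup G} {genG : V → G} {L : Language (V × Bool)}
  {W : DFA (U × Bool) σ} {A : DFA (V × Bool) τ} {B : DFA (V × Bool) ρ}

theorem hnnDFA_evalFrom_none (u : List (HNNGenerator U V × Bool)) :
    (hnnDFA W A B).evalFrom none u = none := by
  induction u with
  | nil => rfl
  | cons a u ih => rw [DFA.evalFrom_cons]; exact ih

theorem not_hnnDFA_evalFrom_none_mem (u : List (HNNGenerator U V × Bool)) :
    (hnnDFA W A B).evalFrom none u ∉ (hnnDFA W A B).accept := by
  rw [hnnDFA_evalFrom_none]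
  rintro ⟨q, r, e, h, -⟩
  cases h

theorem isStableReduced_valList_cons {x : Bool × List (V × Bool)}
    {l : List (Bool × List (V × Bool))} : IsStableReduced H (valList genG (x :: l)) ↔
      (wordVal genG x.2 ∈ H → ∀ f ∈ l.head?.map Prod.fst, x.1 = f) ∧
        IsStableReduced H (valList genG l) := by
  rw [valList_cons, IsStableReduced, List.isChain_cons]
  refine and_congr_left fun _ => ?_
  cases l with
  | nil => simp
  | cons y l => simp

/-- Here `w` is the unread rest of the current block. The last clause is reducedness at the junction
of that block with the next stable letter, which `IsStableReduced` of the remaining list does not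
see. -/
theorem hnnDFA_evalFrom_inr (hA : A.accepts = L)
    (hB : B.accepts = ({w | w ∈ L ∧ wordVal genG w ∈ H} : Language (V × Bool)))
    (u : List (HNNGenerator U V × Bool)) (q : τ) (r : ρ) (e : Option Bool) :
    (hnnDFA W A B).evalFrom (some (.inr (q, r, e))) u ∈ (hnnDFA W A B).accept ↔
      ∃ (w : List (V × Bool)) (l : List (Bool × List (V × Bool))),
        u = baseWord w ++ tailWord l ∧ A.evalFrom q w ∈ A.accept ∧
        (∀ x ∈ l, x.2 ∈ L) ∧ IsStableReduced H (valList genG l) ∧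
        (B.evalFrom r w ∈ B.accept → ∀ f ∈ l.head?.map Prod.fst, ∀ e' ∈ e, e' = f) := by
  induction u generalizing q r e with
  | nil =>
    constructor
    · rintro ⟨q', r', e', h, hq⟩
      cases h
      exact ⟨[], [], rfl, hq, by simp, List.isChain_nil, by simp⟩
    · rintro ⟨w, l, hu, hq, -⟩
      obtain ⟨hw, -⟩ := List.append_eq_nil_iff.1 hu.symm
      obtain rfl := List.map_eq_nil_iff.1 hw
      exact ⟨q, r, e, rfl, hq⟩
  | cons a u ih =>
    rw [DFA.evalFrom_cons]
    obtain ⟨a, b⟩ := a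
    cases a with
    | sub s =>
      refine iff_of_false (not_hnnDFA_evalFrom_none_mem _) ?_
      rintro ⟨w, l, hu, -⟩
      cases w <;> cases l <;> simp [baseWord, tailWord, Prod.ext_iff] at hu
    | sep =>
      refine iff_of_false (not_hnnDFA_evalFrom_none_mem _) ?_
      rintro ⟨w, l, hu, -⟩
      cases w <;> cases l <;> simp [baseWord, tailWord, Prod.ext_iff] at hu
    | base s =>
      refine (ih (A.step q (s, b)) (B.step r (s, b)) e).trans ⟨?_, ?_⟩
      · rintro ⟨w, l, rfl, h⟩
        exact ⟨(s, b) :: w, l, rfl, h⟩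
      · rintro ⟨w, l, hu, h⟩
        cases w with
        | nil => cases l <;> simp [baseWord, tailWord, Prod.ext_iff] at hu
        | cons c w =>
          obtain ⟨c, b'⟩ := c
          simp only [baseWord, List.map_cons, List.cons_append, Prod.map_apply, id_eq,
            List.cons.injEq, Prod.mk.injEq, base.injEq] at hu
          obtain ⟨⟨rfl, rfl⟩, rfl⟩ := hu
          exact ⟨w, l, rfl, h⟩
    | stable =>
      by_cases hc : q ∈ A.accept ∧ (r ∈ B.accept → ∀ e' ∈ e, e' = b)
      · have hstep : (hnnDFA W A B).step (some (.inr (q, r, e))) (stable, b) =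
            some (.inr (A.start, B.start, some b)) := if_pos hc
        rw [hstep, ih]
        constructor
        · rintro ⟨w, l, rfl, hw, hl, hred, hsign⟩
          have hwL : w ∈ L := hA ▸ hw
          refine ⟨[], (b, w) :: l, rfl, hc.1, List.forall_mem_cons.2 ⟨hwL, hl⟩,
            isStableReduced_valList_cons.2 ⟨fun hwH f hf => ?_, hred⟩, fun hr f hf => ?_⟩
          · have : w ∈ B.accepts := by rw [hB]; exact ⟨hwL, hwH⟩
            exact hsign this f hf b rfl
          · obtain rfl : b = f := by simpa using hf
            exact hc.2 hr
        · rintro ⟨w, l, hu, hw, hl, hred, hsign⟩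
          cases w with
          | cons c w => simp [baseWord, Prod.ext_iff] at hu
          | nil =>
            cases l with
            | nil => simp [baseWord, tailWord] at hu
            | cons x l =>
              obtain ⟨f, w⟩ := x
              simp only [baseWord, List.map_nil, List.nil_append, tailWord, List.cons.injEq,
                Prod.mk.injEq, true_and] at hu
              obtain ⟨rfl, rfl⟩ := hu
              obtain ⟨hwL, hl⟩ := List.forall_mem_cons.1 hl
              obtain ⟨h1, h2⟩ := isStableReduced_valList_cons.1 hred
              refine ⟨w, l, rfl, ?_, hl, h2, fun hwB f hf e' he' => ?_⟩
              · change w ∈ A.accepts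
                rwa [hA]
              · have : w ∈ B.accepts := hwB
                rw [hB] at this
                obtain rfl : b = e' := by simpa using he'
                exact h1 this.2 f hf
      · have hstep : (hnnDFA W A B).step (some (.inr (q, r, e))) (stable, b) = none := if_neg hc
        rw [hstep]
        refine iff_of_false (not_hnnDFA_evalFrom_none_mem _) ?_
        rintro ⟨w, l, hu, hw, hl, hred, hsign⟩
        cases w with
        | cons c w => simp [baseWord, Prod.ext_iff] at hu
        | nil =>
          cases l with
          | nil => simp [baseWord, tailWord] at hu
          | cons x l =>
            obtain ⟨f, w⟩ := x
            simp only [baseWord, List.map_nil, List.nil_append, tailWord, List.cons.injEq,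
              Prod.mk.injEq, true_and] at hu
            obtain ⟨rfl, rfl⟩ := hu
            exact hc ⟨hw, fun hr => hsign hr b rfl⟩

theorem hnnDFA_evalFrom_inl (hA : A.accepts = L)
    (hB : B.accepts = ({w | w ∈ L ∧ wordVal genG w ∈ H} : Language (V × Bool)))
    (u : List (HNNGenerator U V × Bool)) (q : σ) :
    (hnnDFA W A B).evalFrom (some (.inl q)) u ∈ (hnnDFA W A B).accept ↔
      ∃ (v : List (U × Bool)) (w : List (V × Bool)) (l : List (Bool × List (V × Bool))),
        W.evalFrom q v ∈ W.accept ∧ w ∈ L ∧ (∀ x ∈ l, x.2 ∈ L) ∧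
          IsStableReduced H (valList genG l) ∧ u = hnnWord v w l := by
  induction u generalizing q with
  | nil =>
    refine iff_of_false ?_ ?_
    · rintro ⟨q', r', e', h, hq⟩
      cases h
    · rintro ⟨v, w, l, -, -, -, -, hu⟩
      simp [hnnWord] at hu
  | cons a u ih =>
    rw [DFA.evalFrom_cons]
    obtain ⟨a, b⟩ := a
    cases a with
    | stable =>
      refine iff_of_false (not_hnnDFA_evalFrom_none_mem _) ?_
      rintro ⟨v, w, l, -, -, -, -, hu⟩
      cases v <;> simp [hnnWord, subWord, Prod.ext_iff] at hu
    | base s =>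
      refine iff_of_false (not_hnnDFA_evalFrom_none_mem _) ?_
      rintro ⟨v, w, l, -, -, -, -, hu⟩
      cases v <;> simp [hnnWord, subWord, Prod.ext_iff] at hu
    | sub s =>
      refine (ih (W.step q (s, b))).trans ⟨?_, ?_⟩
      · rintro ⟨v, w, l, hv, hw, hl, hred, rfl⟩
        exact ⟨(s, b) :: v, w, l, hv, hw, hl, hred, rfl⟩
      · rintro ⟨v, w, l, hv, hw, hl, hred, hu⟩
        cases v with
        | nil => simp [hnnWord, subWord, Prod.ext_iff] at hu
        | cons c v =>
          obtain ⟨c, b'⟩ := c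
          simp only [hnnWord, subWord, List.map_cons, List.cons_append, Prod.map_apply, id_eq,
            List.cons.injEq, Prod.mk.injEq, sub.injEq] at hu
          obtain ⟨⟨rfl, rfl⟩, rfl⟩ := hu
          exact ⟨v, w, l, hv, hw, hl, hred, rfl⟩
    | sep =>
      cases b with
      | false =>
        refine iff_of_false (not_hnnDFA_evalFrom_none_mem _) ?_
        rintro ⟨v, w, l, -, -, -, -, hu⟩
        cases v <;> simp [hnnWord, subWord, Prod.ext_iff] at hu
      | true =>
        by_cases hc : q ∈ W.accept
        · have hstep : (hnnDFA W A B).step (some (.inl q)) (sep, true) =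
              some (.inr (A.start, B.start, none)) := if_pos hc
          rw [hstep, hnnDFA_evalFrom_inr hA hB]
          constructor
          · rintro ⟨w, l, rfl, hw, hl, hred, -⟩
            exact ⟨[], w, l, hc, hA ▸ hw, hl, hred, rfl⟩
          · rintro ⟨v, w, l, hv, hw, hl, hred, hu⟩
            cases v with
            | cons c v => simp [hnnWord, subWord, Prod.ext_iff] at hu
            | nil =>
              refine ⟨w, l, (List.cons.inj hu).2, ?_, hl, hred, by simp⟩
              change w ∈ A.accepts
              rwa [hA]
        · have hstep : (hnnDFA W A B).step (some (.inl q)) (sep, true) = none := if_neg hc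
          rw [hstep]
          refine iff_of_false (not_hnnDFA_evalFrom_none_mem _) ?_
          rintro ⟨v, w, l, hv, -, -, -, hu⟩
          cases v with
          | cons c v => simp [hnnWord, subWord, Prod.ext_iff] at hu
          | nil => exact hc hv

theorem isRegular_hnnLanguage {LH : Language (U × Bool)} (hLH : LH.IsRegular)
    (hL : IsCosetLanguage genG H L) : (hnnLanguage H genG LH L).IsRegular := by
  obtain ⟨σ, _, W, hW⟩ := hLH
  obtain ⟨τ, _, A, hA⟩ := hL.isRegular
  obtain ⟨ρ, _, B, hB⟩ := hL.isRegular_inter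
  refine ⟨_, inferInstance, hnnDFA W A B, Set.ext fun u => ?_⟩
  refine (hnnDFA_evalFrom_inl hA hB u W.start).trans ⟨?_, ?_⟩
  · rintro ⟨v, w, l, hv, hw, hl⟩
    exact ⟨v, hW ▸ hv, w, hw, l, hl⟩
  · rintro ⟨v, hv, w, hw, l, hl⟩
    rw [← hW] at hv
    exact ⟨v, w, l, hv, hw, hl⟩

end Regular

/-! ### Word differences in the HNN extension -/

section Differences

variable {G : Type*} [Group G] {H : Subgroup G} {φ : H ≃* H} {U V : Type} {genH : U → H}
  {genG : V → G} {LH : Language (U × Bool)} {L : Language (V × Bool)}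

/-- Membership in `F` travels from right to left: the induction hypothesis bounds the element `k`
behind the first stable letter, and conjugation followed by `hinv` bounds `h`. The extra word `r`
allows the right tape to be longer than its matching part, as is needed when a stable letter
cancels. -/
theorem tail_differences {F : Set H} (hφ : ∀ h ∈ F, φ h ∈ F) (hφ' : ∀ h ∈ F, φ.symm h ∈ F)
    (hinv : ∀ w ∈ L, ∀ x ∈ L, ∀ h ∈ F, ∀ h' : H,
      wordVal genG w * (h : G) = h' * wordVal genG x → h' ∈ F) {g : G}
    (hg : ∀ w ∈ L, ∀ x ∈ L, ∀ h : H, wordVal genG w * g = h * wordVal genG x → h ∈ F)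
    {D : Set G} (hD : ∀ g' ∈ insert g (Subtype.val '' F), ∀ w ∈ L, ∀ x ∈ L, ∀ h ∈ H,
      wordVal genG w * g' = h * wordVal genG x →
        ∀ t : ℕ, (wordVal genG (w.take t))⁻¹ * h * wordVal genG (x.take t) ∈ D)
    {l l' : List (Bool × List (V × Bool))} (hl : ∀ x ∈ l, x.2 ∈ L) (hl' : ∀ x ∈ l', x.2 ∈ L)
    (hred : IsStableReduced H (valList genG l)) (hred' : IsStableReduced H (valList genG l'))
    {w x : List (V × Bool)} (hw : w ∈ L) (hx : x ∈ L) {h : H}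
    (heq : (of (wordVal genG w) * stableProd φ (valList genG l) * of g : HNNExtension G H H φ) =
      of (h : G) * (of (wordVal genG x) * stableProd φ (valList genG l')))
    {r : List (HNNGenerator U V × Bool)} (hr : ∀ a ∈ r.head?, isDelimiter a = true) :
    h ∈ F ∧ ∀ p, p <+: asyncPad isDelimiter (baseWord w ++ tailWord l)
        (baseWord x ++ (tailWord l' ++ r)) →
      (∃ d ∈ D, (wordVal (hnnGen φ genH genG) (leftTape p))⁻¹ * of (h : G) *
        wordVal (hnnGen φ genH genG) (rightTape p) = of d) ∨
      ∃ t, leftTape p = baseWord w ++ tailWord l ∧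
        rightTape p = baseWord x ++ (tailWord l' ++ r.take t) := by
  have block : ∀ {g' : G} {w x : List (V × Bool)} {h : H}, g' ∈ insert g (Subtype.val '' F) →
      w ∈ L → x ∈ L → wordVal genG w * g' = h * wordVal genG x →
      ∀ (t : ℕ) (u v : List (HNNGenerator U V × Bool)), u = (baseWord w).take t →
        v = (baseWord x).take t → ∃ d ∈ D, (wordVal (hnnGen φ genH genG) u)⁻¹ * of (h : G) *
          wordVal (hnnGen φ genH genG) v = of d := by
    rintro g' w x h hg' hw hx heq t _ _ rfl rfl
    refine ⟨_, hD g' hg' w hw x hx h h.2 heq t, ?_⟩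
    rw [baseWord, baseWord, ← List.map_take, ← List.map_take, ← baseWord, ← baseWord,
      wordVal_baseWord, wordVal_baseWord]
    simp
  induction l generalizing w x l' h with
  | nil =>
    obtain ⟨hnil, hval⟩ := britton_nil_mul_right (φ := φ) (g := g) (a := wordVal genG w)
      (a' := h * wordVal genG x) hred' (by simpa [mul_assoc] using heq)
    obtain rfl := List.map_eq_nil_iff.1 hnil
    refine ⟨hg w hw x hx h hval, fun p hp => ?_⟩
    rcases tapes_prefix_asyncPad_append (isDelimiter_baseWord w) (isDelimiter_baseWord x)
      (by simp [tailWord]) (by simpa [tailWord] using hr) hp with ⟨t, h1, h2⟩ | ⟨p', hp', h1, h2⟩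
    · exact Or.inl (block (Set.mem_insert _ _) hw hx hval t _ _ h1 h2)
    · obtain ⟨t, h3, h4⟩ := tapes_prefix_asyncPad_nil hp'
      exact Or.inr ⟨t, by rw [h1, h3, tailWord], by rw [h2, h4]; simp [tailWord]⟩
  | cons y l ih =>
    obtain ⟨e, y⟩ := y
    obtain ⟨hy, hltail⟩ := List.forall_mem_cons.1 hl
    have hredl := (isStableReduced_valList_cons.1 hred).2
    obtain ⟨b, l'', hl'', k, hk, hrest⟩ := britton_cons_mul_right (φ := φ)
      (x := (e, wordVal genG y)) (l := valList genG l)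
      (a := wordVal genG w) (a' := h * wordVal genG x) (g := g) hred hred'
      (by rw [map_mul (of : G →* HNNExtension G H H φ)]; simpa only [valList_cons, mul_assoc] using heq)
    cases l' with
    | nil => simp at hl''
    | cons z l' =>
      obtain ⟨e', z⟩ := z
      rw [valList_cons, List.cons.injEq, Prod.mk.injEq] at hl''
      obtain ⟨⟨rfl, rfl⟩, rfl⟩ := hl''
      obtain ⟨hz, hltail'⟩ := List.forall_mem_cons.1 hl'
      have hredl' := (isStableReduced_valList_cons.1 hred').2
      obtain ⟨hkF, hdiff⟩ := ih hltail hltail' hredl hredl' hy hz hrest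
      have hconj : stableConj φ e' k ∈ F := by
        cases e'
        · exact hφ' k hkF
        · exact hφ k hkF
      refine ⟨hinv w hw x hx _ hconj h hk, fun p hp => ?_⟩
      have hblock := block (Set.mem_insert_of_mem _ ⟨_, hconj, rfl⟩) hw hx hk
      rcases tapes_prefix_asyncPad_append (isDelimiter_baseWord w) (isDelimiter_baseWord x)
        (by simp [tailWord, isDelimiter]) (by simp [tailWord, isDelimiter]) hp with
        ⟨t, h1, h2⟩ | ⟨p', hp', h1, h2⟩
      · exact Or.inl (hblock t _ _ h1 h2)
      · rw [tailWord, tailWord, List.cons_append, asyncPad_cons_cons_of_eq rfl,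
          List.append_assoc] at hp'
        cases p' with
        | nil =>
          -- Both blocks have been read and the delimiters have not; any `t` that exceeds both
          -- lengths describes this situation.
          refine Or.inl (hblock (max (baseWord w : List (HNNGenerator U V × Bool)).length
            (baseWord x : List (HNNGenerator U V × Bool)).length) _ _ ?_ ?_)
          · rw [h1, List.take_of_length_le (le_max_left _ _)]; simp
          · rw [h2, List.take_of_length_le (le_max_right _ _)]; simp
        | cons c p' =>
          obtain ⟨rfl, hp''⟩ := List.cons_prefix_cons.1 hp'
          rcases hdiff p' hp'' with ⟨d, hd, hval⟩ | ⟨t, h3, h4⟩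
          · refine Or.inl ⟨d, hd, ?_⟩
            have hk' : (of (h : G) : HNNExtension G H H φ) * of (wordVal genG x) =
                of (wordVal genG w) * of (stableConj φ e' k : G) := by
              rw [← map_mul, ← map_mul, hk]
            have hs := stableLetter_mul_of φ e' k
            rw [← hval, h1, h2]
            simp only [leftTape_cons_some, rightTape_cons_some, wordVal_append, wordVal_baseWord,
              wordVal_cons, letterVal_stable, mul_inv_rev]
            simp only [mul_assoc]
            congr 1
            rw [← mul_assoc (of (h : G)), hk']
            simp only [mul_assoc, inv_mul_cancel_left]
            rw [← mul_assoc (of (stableConj φ e' k : G)), ← hs]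
            simp only [mul_assoc, inv_mul_cancel_left]
          · refine Or.inr ⟨t, ?_, ?_⟩
            · rw [h1, leftTape_cons_some, h3, tailWord]
            · rw [h2, rightTape_cons_some, h4, tailWord]
              simp

variable (hLH : IsCosetLanguage genH ⊥ LH) (hL : IsCosetLanguage genG H L)
  (hinv : ∀ E : Set H, E.Finite → ∃ F : Set H, F.Finite ∧ E ⊆ F ∧ (∀ h ∈ F, φ h ∈ F) ∧
    (∀ h ∈ F, φ.symm h ∈ F) ∧ ∀ w ∈ L, ∀ x ∈ L, ∀ h ∈ F, ∀ h' : H,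
      wordVal genG w * (h : G) = h' * wordVal genG x → h' ∈ F)
include hLH hL hinv

/-- Cancelling `v` turns the equation into one between the parts behind `$`, with `h = v⁻¹ v'`. The
bound on `h` from those parts is what makes `v` and `v'` fellow travel in `H`. -/
theorem hnnWord_differences (g : G) : ∃ D : Set (HNNExtension G H H φ), D.Finite ∧
    ∀ v ∈ LH, ∀ w ∈ L, ∀ l : List (Bool × List (V × Bool)), (∀ x ∈ l, x.2 ∈ L) →
      IsStableReduced H (valList genG l) →
    ∀ v' ∈ LH, ∀ x ∈ L, ∀ l' : List (Bool × List (V × Bool)), (∀ x ∈ l', x.2 ∈ L) →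
      IsStableReduced H (valList genG l') →
    wordVal (hnnGen φ genH genG) (hnnWord v w l) * of g =
      wordVal (hnnGen φ genH genG) (hnnWord v' x l') →
    ∀ r : List (HNNGenerator U V × Bool), (∀ a ∈ r.head?, isDelimiter a = true) →
    ∀ p, p <+: asyncPad isDelimiter (hnnWord v w l) (hnnWord v' x l' ++ r) →
      wordDiff (hnnGen φ genH genG) p ∈ D ∨
        ∃ t, leftTape p = hnnWord v w l ∧ rightTape p = hnnWord v' x l' ++ r.take t := by
  obtain ⟨D₀, hD₀, hd₀⟩ := hL.fellowTravels g
  -- The linking element of the last syllable is its difference at `t = 0`, so `F` is made to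
  -- contain `D₀ ∩ H`.
  obtain ⟨F, hF, hEF, hφ, hφ', hFinv⟩ := hinv {h : H | (h : G) ∈ D₀}
    (hD₀.preimage Subtype.val_injective.injOn)
  obtain ⟨D₁, hD₁, hd₁⟩ := exists_finite_of_fellowTravels hL.fellowTravels
    ((hF.image Subtype.val).insert g)
  obtain ⟨D₂, hD₂, hd₂⟩ := exists_finite_of_fellowTravels hLH.fellowTravels hF
  refine ⟨of '' D₁ ∪ (fun h : H => of (h : G)) '' D₂, (hD₁.image _).union (hD₂.image _), ?_⟩
  intro v hv w hw l hl hred v' hv' x hx l' hl' hred' heq r hr p hp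
  set h : H := (wordVal genH v)⁻¹ * wordVal genH v' with hh
  have hstart : (of (wordVal genG w) * stableProd φ (valList genG l) * of g :
      HNNExtension G H H φ) =
      of (h : G) * (of (wordVal genG x) * stableProd φ (valList genG l')) := by
    rw [wordVal_hnnWord, wordVal_hnnWord, mul_assoc, ← eq_inv_mul_iff_mul_eq] at heq
    rw [heq, hh]
    simp [mul_assoc]
  obtain ⟨hhF, hdiff⟩ := tail_differences (φ := φ) (genH := genH) hφ hφ' hFinv (g := g) (D := D₁)
    (fun w hw x hx h heq => hEF (by simpa using hd₀ w hw x hx h h.2 heq 0)) hd₁ hl hl' hred hred'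
    hw hx hstart hr
  have hsub := hd₂ h hhF v hv v' hv' 1 (one_mem _) (by rw [hh]; group)
  have hsub' : ∀ (t : ℕ) (u u' : List (HNNGenerator U V × Bool)), u = (subWord v).take t →
      u' = (subWord v').take t → (wordVal (hnnGen φ genH genG) u)⁻¹ *
          wordVal (hnnGen φ genH genG) u' ∈ (fun h : H => (of (h : G) : HNNExtension G H H φ)) '' D₂ := by
    rintro t _ _ rfl rfl
    refine ⟨_, hsub t, ?_⟩
    rw [subWord, subWord, ← List.map_take, ← List.map_take, ← subWord, ← subWord,
      wordVal_subWord, wordVal_subWord]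
    simp
  rw [hnnWord, hnnWord, List.append_assoc] at hp
  rcases tapes_prefix_asyncPad_append (isDelimiter_subWord v) (isDelimiter_subWord v')
    (by simp [isDelimiter]) (by simp [isDelimiter]) hp with ⟨t, h1, h2⟩ | ⟨p', hp', h1, h2⟩
  · exact Or.inl (Or.inr (hsub' t _ _ h1 h2))
  · rw [List.cons_append, asyncPad_cons_cons_of_eq rfl, List.append_assoc] at hp'
    cases p' with
    | nil =>
      refine Or.inl (Or.inr (hsub' (max (subWord v : List (HNNGenerator U V × Bool)).length
        (subWord v' : List (HNNGenerator U V × Bool)).length) _ _ ?_ ?_))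
      · rw [h1, List.take_of_length_le (le_max_left _ _)]; simp
      · rw [h2, List.take_of_length_le (le_max_right _ _)]; simp
    | cons c p' =>
      obtain ⟨rfl, hp''⟩ := List.cons_prefix_cons.1 hp'
      rcases hdiff p' hp'' with ⟨d, hd, hval⟩ | ⟨t, h3, h4⟩
      · refine Or.inl (Or.inl ⟨d, hd, ?_⟩)
        rw [← hval, wordDiff, h1, h2, hh]
        simp [mul_assoc]
      · refine Or.inr ⟨t, ?_, ?_⟩
        · rw [h1, leftTape_cons_some, h3, hnnWord]
        · rw [h2, rightTape_cons_some, h4, hnnWord]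
          simp

theorem base_differences (g : G) : ∃ D : Set (HNNExtension G H H φ), D.Finite ∧
    ∀ P ∈ hnnLanguage H genG LH L, ∀ Q ∈ hnnLanguage H genG LH L,
      wordVal (hnnGen φ genH genG) P * of g = wordVal (hnnGen φ genH genG) Q →
      ∀ p, p <+: asyncPad isDelimiter P Q → wordDiff (hnnGen φ genH genG) p ∈ D := by
  obtain ⟨D, hD, hd⟩ := hnnWord_differences hLH hL hinv g
  refine ⟨insert (of g) D, hD.insert _, ?_⟩
  rintro _ ⟨v, hv, w, hw, l, hl, hred, rfl⟩ _ ⟨v', hv', x, hx, l', hl', hred', rfl⟩ heq p hp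
  rcases hd v hv w hw l hl hred v' hv' x hx l' hl' hred' heq [] (by simp) p
    (by rwa [List.append_nil]) with h | ⟨t, h1, h2⟩
  · exact Set.mem_insert_of_mem _ h
  · refine Set.mem_insert_iff.2 (Or.inl ?_)
    rw [wordDiff, h1, h2, List.take_nil, List.append_nil, ← heq, inv_mul_cancel_left]

/-- The word ends in `z^{-e} y` with `y ∈ H`, and `z^{-e} y z^e` is an element of `H`. So `Q`
differs from the word without this end by an element of `G`, and the end itself adds only finitely
many differences. -/
theorem stable_differences_of_not_reduced (e : Bool) :
    ∃ D : Set (HNNExtension G H H φ), D.Finite ∧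
    ∀ v ∈ LH, ∀ w ∈ L, ∀ l : List (Bool × List (V × Bool)), (∀ x ∈ l, x.2 ∈ L) →
      IsStableReduced H (valList genG l) → ¬ IsStableReduced H (valList genG l ++ [(e, 1)]) →
    ∀ Q ∈ hnnLanguage H genG LH L,
      wordVal (hnnGen φ genH genG) (hnnWord v w l) * stableLetter φ e =
        wordVal (hnnGen φ genH genG) Q →
      ∀ p, p <+: asyncPad isDelimiter Q (hnnWord v w l) →
        wordDiff (hnnGen φ genH genG) p ∈ D := by
  set N := {n : G | ∃ w ∈ L, wordVal genG w ∈ H ∧ ∃ t : ℕ, n = wordVal genG (w.take t)} with hN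
  have hNfin : N.Finite := hL.finite_prefix_values
  choose D hD hd using hnnWord_differences (φ := φ) hLH hL hinv
  -- These are the inverses of the elements `z^{-e} k z^e`, where `k` runs through a finite set that
  -- contains every possible value of `y`.
  set E : Set G := (fun h : H => ((stableConj φ (!e) h : H) : G)⁻¹) '' (Subtype.val ⁻¹' N) with hE
  have hEfin : E.Finite := (hNfin.preimage Subtype.val_injective.injOn).image _
  refine ⟨(⋃ k ∈ E, D k) ∪ (of '' E ∪ Set.image2
    (fun k n => of k * (stableLetter φ (!e) * of n)) E N),
    (hEfin.biUnion fun k _ => hD k).union ((hEfin.image _).union (hEfin.image2 _ hNfin)), ?_⟩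
  rintro v hv w hw l hl hred hnred _ ⟨v', hv', x, hx, l', hl', hred', rfl⟩ heq p hp
  rcases List.eq_nil_or_concat' l with rfl | ⟨l, ⟨e', y⟩, rfl⟩
  · exact absurd (List.isChain_singleton _) hnred
  have hy : y ∈ L := hl (e', y) (by simp)
  have hval : valList genG (l ++ [(e', y)]) = valList genG l ++ [(e', wordVal genG y)] := by
    simp [valList]
  have hlast : wordVal genG y ∈ H ∧ e' = !e := by
    rw [hval] at hnred hred
    rw [IsStableReduced, List.isChain_append] at hnred
    by_contra hcon
    refine hnred ⟨hred, List.isChain_singleton _, fun a ha b hb haH => ?_⟩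
    obtain rfl : (e', wordVal genG y) = a := by simpa using ha
    obtain rfl : (e, 1) = b := by simpa using hb
    by_contra hne
    exact hcon ⟨haH, Bool.eq_not.2 hne⟩
  obtain ⟨hyH, rfl⟩ := hlast
  have hred₁ : IsStableReduced H (valList genG l) := by
    rw [hval, IsStableReduced, List.isChain_append] at hred
    exact hred.1
  set k : H := ⟨wordVal genG y, hyH⟩ with hk
  have hkE : ((stableConj φ (!e) k : H) : G)⁻¹ ∈ E :=
    ⟨k, ⟨y, hy, hyH, y.length, by simp [hk]⟩, rfl⟩
  have hword : (hnnWord v w (l ++ [(!e, y)]) : List (HNNGenerator U V × Bool)) =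
      hnnWord v w l ++ (stable, !e) :: baseWord y := by
    simp [hnnWord, tailWord_append, tailWord]
  have hback : wordVal (hnnGen φ genH genG) (hnnWord v' x l') *
      of ((stableConj φ (!e) k : H) : G)⁻¹ = wordVal (hnnGen φ genH genG) (hnnWord v w l) := by
    have hs := stableLetter_mul_of φ (!e) k
    have he : stableLetter φ e = (stableLetter φ (!e))⁻¹ := by
      rw [stableLetter_not, inv_inv]
    rw [← heq, hword, wordVal_append, wordVal_cons, wordVal_baseWord, letterVal_stable,
      map_inv, mul_inv_eq_iff_eq_mul, he, mul_assoc, mul_inv_eq_iff_eq_mul.2 hs]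
  rw [hword] at hp
  rcases hd _ v' hv' x hx l' hl' hred' v hv w hw l (fun z hz => hl z (by simp [hz])) hred₁ hback
    ((stable, !e) :: baseWord y) (by simp [isDelimiter]) p hp with h | ⟨t, h1, h2⟩
  · exact Or.inl (Set.mem_biUnion hkE h)
  · refine Or.inr ?_
    rw [wordDiff, h1, h2, wordVal_append, ← hback, mul_assoc, inv_mul_cancel_left]
    cases t with
    | zero => exact Or.inl ⟨_, hkE, by simp⟩
    | succ t =>
      refine Or.inr ⟨_, hkE, wordVal genG (y.take t), ⟨y, hy, hyH, t, rfl⟩, ?_⟩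
      rw [List.take_succ_cons, wordVal_cons, letterVal_stable, baseWord, ← List.map_take,
        ← baseWord, wordVal_baseWord]

omit hLH hL hinv in
theorem wordDiff_mem_inv_of_swap {T K : Type*} [Group K] {gen : T → K} {δ : T × Bool → Bool}
    {D : Set K} {u v : List (T × Bool)}
    (h : ∀ p, p <+: asyncPad δ u v → wordDiff gen p ∈ D) :
    ∀ p, p <+: asyncPad δ v u → wordDiff gen p ∈ Inv.inv '' D := by
  intro p hp
  obtain ⟨p', hp', h1, h2⟩ := exists_prefix_asyncPad_swap hp
  exact ⟨_, h p' hp', by rw [wordDiff, wordDiff, h1, h2, mul_inv_rev, inv_inv]⟩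

/-- The equation also reads `Q z^{-e} = P`. One of the two products is not reduced, and the
comparison is made from that side; inverting the differences accounts for exchanged tapes. -/
theorem stable_differences (e : Bool) : ∃ D : Set (HNNExtension G H H φ), D.Finite ∧
    ∀ P ∈ hnnLanguage H genG LH L, ∀ Q ∈ hnnLanguage H genG LH L,
      wordVal (hnnGen φ genH genG) P * stableLetter φ e = wordVal (hnnGen φ genH genG) Q →
      ∀ p, p <+: asyncPad isDelimiter P Q → wordDiff (hnnGen φ genH genG) p ∈ D := by
  choose D hD hd using stable_differences_of_not_reduced (φ := φ) hLH hL hinv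
  refine ⟨Inv.inv '' D e ∪ D (!e), ((hD e).image _).union (hD _), ?_⟩
  intro P hP Q hQ heq p hp
  have hP' := hP
  have hQ' := hQ
  obtain ⟨v, hv, w, hw, l, hl, hred, rfl⟩ := hP'
  obtain ⟨v', hv', x, hx, l', hl', hred', rfl⟩ := hQ'
  have heq' : wordVal (hnnGen φ genH genG) (hnnWord v' x l') * stableLetter φ (!e) =
      wordVal (hnnGen φ genH genG) (hnnWord v w l) := by
    rw [stableLetter_not, mul_inv_eq_iff_eq_mul, heq]
  by_cases h1 : IsStableReduced H (valList genG l ++ [(e, 1)])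
  · by_cases h2 : IsStableReduced H (valList genG l' ++ [(!e, 1)])
    · exfalso
      -- If both products were reduced, Britton's lemma would give each word one stable letter more
      -- than the other.
      have length_eq : ∀ {m m' : List (Bool × G)} {a b c d : G} {f : Bool},
          IsStableReduced H (m ++ [(f, 1)]) → IsStableReduced H m' →
          (of a * (of b * stableProd φ m) * stableLetter φ f : HNNExtension G H H φ) =
            of c * (of d * stableProd φ m') → m.length + 1 = m'.length := by
        intro m m' a b c d f hm hm' h
        have := congrArg List.length (britton (φ := φ) hm hm' (g := a * b) (g' := c * d)
          (by simpa [mul_assoc] using h)).1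
        simpa using this
      rw [wordVal_hnnWord, wordVal_hnnWord] at heq heq'
      have e1 := length_eq h1 hred' heq
      have e2 := length_eq h2 hred heq'
      omega
    · exact Or.inr (hd (!e) v' hv' x hx l' hl' hred' h2 _ hP heq' p hp)
  · exact Or.inl (wordDiff_mem_inv_of_swap (hd e v hv w hw l hl hred h1 _ hQ heq) p hp)

theorem isAsyncAutomatic_hnnExtension [Finite U] [Finite V] :
    IsAsyncAutomatic (HNNExtension G H H φ) := by
  refine isAsyncAutomatic_of_finite_wordDiff (hnnGen φ genH genG) (hnnLanguage H genG LH L)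
    (isRegular_hnnLanguage hLH.isRegular hL) isDelimiter
    (exists_mem_hnnLanguage φ (fun h => ?_) hL.exists_word) ?_
  · obtain ⟨v, hv, k, hk, rfl⟩ := hLH.exists_word h
    exact ⟨v, hv, by rw [Subgroup.mem_bot.1 hk, one_mul]⟩
  · have hbase : ∀ (a : Option (HNNGenerator U V × Bool)) (g : G),
        paddedLetterVal (hnnGen φ genH genG) a = of g → ∃ D : Set (HNNExtension G H H φ),
          D.Finite ∧ ∀ P ∈ hnnLanguage H genG LH L, ∀ Q ∈ hnnLanguage H genG LH L,
            wordVal (hnnGen φ genH genG) P * paddedLetterVal (hnnGen φ genH genG) a =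
              wordVal (hnnGen φ genH genG) Q →
            ∀ p, p <+: asyncPad isDelimiter P Q → wordDiff (hnnGen φ genH genG) p ∈ D := by
      intro a g ha
      rw [ha]
      exact base_differences hLH hL hinv g
    rintro (_ | ⟨a, b⟩)
    · exact hbase _ 1 (map_one of).symm
    · cases a with
      | sub u =>
        refine hbase _ (letterVal (fun u => (genH u : G)) (u, b)) ?_
        cases b <;> simp [paddedLetterVal, letterVal, hnnGen]
      | base v =>
        refine hbase _ (letterVal genG (v, b)) ?_
        cases b <;> simp [paddedLetterVal, letterVal, hnnGen]
      | sep =>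
        refine hbase _ 1 ?_
        rw [paddedLetterVal, letterVal_sep, map_one]
      | stable => exact stable_differences hLH hL hinv b

end Differences

/-! ### The presentation of the HNN extension -/

section Presentation

variable {X : Type*} {R : Set (FreeGroup X)} {H : Subgroup (PresentedGroup R)} {Y : Set H}
  {α : H ≃* H} {word : H → FreeGroup X}

/-- The group that is defined by the presentation maps to the HNN extension. -/
def hnnPresentationToExtension
    (hα : ∀ y ∈ Y, α y ∈ Y)
    (hword : ∀ y ∈ Y, PresentedGroup.mk R (word y) = (y : PresentedGroup R)) :
    PresentedGroup (hnnRelators R Y α word) →* HNNExtension (PresentedGroup R) H H α.symm :=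
  PresentedGroup.toGroup (f := fun x => x.elim t fun x => HNNExtension.of (PresentedGroup.of x)) <| by
    have key : ∀ r : FreeGroup X,
        FreeGroup.lift (fun x : Option X => x.elim (t : HNNExtension (PresentedGroup R) H H α.symm)
          fun x => HNNExtension.of (PresentedGroup.of x)) (FreeGroup.map some r) =
        HNNExtension.of (PresentedGroup.mk R r) := by
      intro r
      induction r using FreeGroup.induction_on with
      | C1 => simp
      | of x => simp [PresentedGroup.of]
      | inv_of x h => rw [map_inv, map_inv, map_inv, map_inv, h]
      | mul x y hx hy => rw [map_mul, map_mul, map_mul, map_mul, hx, hy]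
    rintro r (⟨r, hr, rfl⟩ | ⟨y, hy, rfl⟩)
    · rw [key, PresentedGroup.one_of_mem hr, map_one]
    · rw [map_mul, map_mul, map_mul, map_inv, map_inv, key, key, hword y hy, hword _ (hα y hy),
        FreeGroup.lift_apply_of]
      -- In `HNNExtension` the stable letter satisfies `t h t⁻¹ = φ h`, so the relations `z⁻¹ y z =
      -- α y` correspond to `φ = α⁻¹`.
      have h := equiv_symm_eq_conj (φ := α.symm) y
      rw [MulEquiv.symm_symm] at h
      rw [h]
      exact mul_inv_cancel _

/-- The base group maps to the group that is defined by the presentation. -/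
def presentedGroupToHNNPresentation (R : Set (FreeGroup X)) {H : Subgroup (PresentedGroup R)}
    (Y : Set H) (α : H ≃* H) (word : H → FreeGroup X) :
    PresentedGroup R →* PresentedGroup (hnnRelators R Y α word) :=
  QuotientGroup.map _ _ (FreeGroup.map some) <| Subgroup.normalClosure_le_normal fun r hr =>
    Subgroup.subset_normalClosure (Or.inl ⟨r, hr, rfl⟩)

theorem presentedGroupToHNNPresentation_mk (r : FreeGroup X) :
    presentedGroupToHNNPresentation R Y α word (PresentedGroup.mk R r) =
      PresentedGroup.mk (hnnRelators R Y α word) (FreeGroup.map some r) := rfl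

theorem stable_mul_base (hY : Subgroup.closure Y = ⊤) (hα : ∀ y ∈ Y, α y ∈ Y)
    (hword : ∀ y ∈ Y, PresentedGroup.mk R (word y) = (y : PresentedGroup R)) (h : H) :
    PresentedGroup.of none * presentedGroupToHNNPresentation R Y α word h =
      presentedGroupToHNNPresentation R Y α word (α.symm h : H) * PresentedGroup.of none := by
  set ι := presentedGroupToHNNPresentation R Y α word with hι
  -- The relators cover only `y ∈ Y`. Both sides are homomorphisms on `H`, so agreement on the
  -- generating set `Y` gives agreement everywhere.
  have key : (MulAut.conj (PresentedGroup.of none : PresentedGroup (hnnRelators R Y α word))⁻¹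
      ).toMonoidHom.comp (ι.comp H.subtype) = (ι.comp H.subtype).comp α.toMonoidHom := by
    refine MonoidHom.eq_of_eqOn_dense hY fun y hy => ?_
    have hrel : PresentedGroup.mk (hnnRelators R Y α word) _ = 1 :=
      PresentedGroup.one_of_mem (Or.inr ⟨y, hy, rfl⟩)
    rw [map_mul, mul_eq_one_iff_eq_inv, map_inv, inv_inv, map_mul, map_mul, map_inv,
      ← presentedGroupToHNNPresentation_mk, ← presentedGroupToHNNPresentation_mk, hword y hy,
      hword _ (hα y hy)] at hrel
    change (PresentedGroup.of none)⁻¹ * ι y * (PresentedGroup.of none)⁻¹⁻¹ = ι (α y : H)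
    rw [inv_inv]
    exact hrel
  have h1 := DFunLike.congr_fun key (α.symm h)
  simp only [MonoidHom.comp_apply, MulEquiv.toMonoidHom_eq_coe, MonoidHom.coe_coe,
    MulAut.conj_apply, inv_inv, MulEquiv.apply_symm_apply, Subgroup.coe_subtype] at h1
  rw [← h1]
  group

/-- The presentation defines the HNN extension. -/
def hnnPresentationEquiv (hY : Subgroup.closure Y = ⊤) (hα : ∀ y ∈ Y, α y ∈ Y)
    (hword : ∀ y ∈ Y, PresentedGroup.mk R (word y) = (y : PresentedGroup R)) :
    HNNExtension (PresentedGroup R) H H α.symm ≃* PresentedGroup (hnnRelators R Y α word) :=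
  MonoidHom.toMulEquiv
    (HNNExtension.lift (presentedGroupToHNNPresentation R Y α word) (PresentedGroup.of none)
      (stable_mul_base hY hα hword))
    (hnnPresentationToExtension hα hword)
    (by
      refine HNNExtension.hom_ext (PresentedGroup.ext fun x => ?_) ?_
      · rw [MonoidHom.comp_apply, MonoidHom.comp_apply, lift_of]
        exact PresentedGroup.toGroup.of _
      · rw [MonoidHom.comp_apply, lift_t]
        exact PresentedGroup.toGroup.of _)
    (by
      refine PresentedGroup.ext fun x => ?_
      rw [MonoidHom.comp_apply, hnnPresentationToExtension, PresentedGroup.toGroup.of]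
      cases x with
      | none => exact lift_t _ _ _
      | some x => exact lift_of _ _ _ _)

end Presentation

theorem mainTheorem1 {X : Type*} [Finite X] (R : Set (FreeGroup X)) (hR : R.Finite)
    (H : Subgroup (PresentedGroup R))
    {S : Type*} [Finite S] (gen : S → PresentedGroup R)
    (C : AutomaticCosetSystem gen H) (hC : C.IsStrong)
    (hH : IsAutomatic H)
    (Y : Set H) (hYfin : Y.Finite) (hYgen : Subgroup.closure Y = ⊤) (hYeff : C.IsEfficient Y)
    (α : H ≃* H) (hα : α '' Y = Y)
    (word : H → FreeGroup X)
    (hword : ∀ y ∈ Y, PresentedGroup.mk R (word y) = (y : PresentedGroup R)) :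
    IsAsyncAutomatic (PresentedGroup (hnnRelators R Y α word)) := by
  obtain ⟨U, _, genH, ⟨A⟩⟩ := hH
  obtain ⟨n, ⟨e⟩⟩ := Finite.exists_equiv_fin S
  have hcos := (C.isCosetLanguage hC).relabel e.symm
  refine IsAsyncAutomatic.of_mulEquiv
    (hnnPresentationEquiv hYgen (fun y hy => hα ▸ Set.mem_image_of_mem α hy) hword)
    (isAsyncAutomatic_hnnExtension A.isCosetLanguage hcos fun E hE => ?_)
  obtain ⟨F, hF, hEF, h1, h2, h3⟩ := exists_finite_invariant hcos.exists_word
    (fun w hw x hx b h hb heq => hYeff _ hw _ hx b h hb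
      (by rwa [wordVal_relabel, wordVal_relabel])) hYfin hYgen hα hE
  -- The two invariance conditions change places because the extension is formed with `α.symm`.
  exact ⟨F, hF, hEF, h2, by simpa using h1, h3⟩
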